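/- **Setting.** Let $n\ge 1$, $s\in\mathbb R$, $1<p<\infty$, $\frac1p+\frac1{p'}=1$, and let $\Omega\subseteq\mathbb R^n$ be a nonempty open set. All functions are real-valued, $D'(\Omega)$ is the space of distributions on $\Omega$ (the dual of $C_c^\infty(\Omega)$ with its inductive limit topology), and $L^p(\Omega)$ is viewed as a subspace of $D'(\Omega)$. The Sobolev–Slobodeckij spaces $W^{s,p}(\Omega)\subseteq D'(\Omega)$ are defined as follows. - If $s=k\in\mathbb N_0$: $u\in W^{k,p}(\Omega)$ iff $\|u\|_{W^{k,p}(\Omega)}=\sum_{|\nu|\le k}\|\partial^\nu u\|_{L^p(\Omega)}<\infty$. - If $s=k+\theta$ with $k\in\mathbb N_0$, $0<\theta<1$: $u\in W^{s,p}(\Omega)$ iff $\|u\|_{W^{s,p}(\Omega)}=\|u\|_{W^{k,p}(\Omega)}+\sum_{|\nu|=k}\Big(\iint_{\Omega\times\Omega}\frac{|\partial^\nu u(x)-\partial^\nu u(y)|^p}{|x-y|^{n+\theta p}}\,dx\,dy\Big)^{1/p}<\infty$. - If $s<0$: $W^{s,p}(\Omega)=\big(W^{-s,p'}_0(\Omega)\big)^*$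 with the dual norm, where $W^{-s,p'}_0(\Omega)$ is the closure of $C_c^\infty(\Omega)$ in $W^{-s,p'}(\Omega)$; a functional is identified with the distribution obtained by restricting it to $C_c^\infty(\Omega)$. The locally Sobolev space is $$W^{s,p}_{loc}(\Omega)=\{u\in D'(\Omega):\ \varphi u\in W^{s,p}(\Omega)\ \text{for all }\varphi\in C_c^\infty(\Omega)\},$$ with the topology induced by the seminorms $u\mapsto\|\varphi u\|_{W^{s,p}(\Omega)}$, $\varphi\in C_c^\infty(\Omega)$. **Theorem.** Let $s\in\mathbb R$, $1<p<\infty$, $\alpha\in\mathbb N_0^n$, and let $\Omega$ be a nonempty bounded open set in $\mathbb R^n$ with Lipschitz continuous boundary. Let $\partial^\alpha$ be the distributional derivative. 1. The linear operator $\partial^\alpha:W^{s,p}_{loc}(\mathbb R^n)\to W^{s-|\alpha|,p}_{loc}(\mathbb R^n)$ is well-defined and continuous. 2. If $s<0$, the linear operator $\partial^\alpha:W^{s,p}_{loc}(\Omega)\to W^{s-|\alpha|,p}_{loc}(\Omega)$ is well-defined and continuous. 3. If $s\ge0$ and $|\alpha|\le s$, the linear operator $\partial^\alpha:W^{s,p}_{loc}(\Omega)\to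 W^{s-|\alpha|,p}_{loc}(\Omega)$ is well-defined and continuous. 4. If $s\ge0$, $s-\frac1p$ is not an integer, and $|\alpha|>s$, the linear operator $\partial^\alpha:W^{s,p}_{loc}(\Omega)\to W^{s-|\alpha|,p}_{loc}(\Omega)$ is well-defined and continuous. -/

import Mathlib

open MeasureTheory TopologicalSpace Set
open scoped ENNReal NNReal Distributions LineDeriv

noncomputable section

namespace LocSob

/-- Euclidean space `ℝⁿ`. -/
abbrev Eucl (n : ℕ) : Type := EuclideanSpace ℝ (Fin n)

variable {n : ℕ} {Ω : Opens (Eucl n)}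

/-! ### Operations on distributions -/

/-- The distributional derivative `∂^α = ∂₁^{α₁} ⋯ ∂ₙ^{αₙ}` on `D'(Ω)`. -/
def partialD (Ω : Opens (Eucl n)) (α : Fin n → ℕ) : 𝓓'(Ω, ℝ) →L[ℝ] 𝓓'(Ω, ℝ) :=
  (List.ofFn fun i : Fin n =>
    (Distribution.lineDerivCLM (EuclideanSpace.single i (1 : ℝ)) :
      𝓓'(Ω, ℝ) →L[ℝ] 𝓓'(Ω, ℝ)) ^ α i).prod

/-- Multiplication of test functions by a fixed test function, `ψ ↦ φ ψ`. -/
def mulTest (φ : 𝓓(Ω, ℝ)) : 𝓓(Ω, ℝ) →L[ℝ] 𝓓(Ω, ℝ) :=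
  TestFunction.limitCLM ℝ
    (fun ψ => ⟨fun x => φ x * ψ x, φ.contDiff.mul ψ.contDiff, ψ.hasCompactSupport.mul_left,
      (tsupport_mul_subset_right).trans ψ.tsupport_subset⟩)
    (fun _ hK => TestFunction.ofSupportedInCLM ℝ hK ∘L
      ContDiffMapSupportedIn.bilinLeftCLM (ContinuousLinearMap.mul ℝ ℝ) φ.contDiff)
    (fun K hK ψ => by ext x; simp [mul_comm])

@[simp]
theorem mulTest_apply (φ ψ : 𝓓(Ω, ℝ)) (x : Eucl n) : mulTest φ ψ x = φ x * ψ x := rfl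

/-- The product `φ u` of a test function and a distribution, `⟨φ u, ψ⟩ = ⟨u, φ ψ⟩`. -/
def mulDist (φ : 𝓓(Ω, ℝ)) : 𝓓'(Ω, ℝ) →L[ℝ] 𝓓'(Ω, ℝ) :=
  (mulTest φ).precompCompactConvergenceCLM _

@[simp]
theorem mulDist_apply (φ : 𝓓(Ω, ℝ)) (u : 𝓓'(Ω, ℝ)) (ψ : 𝓓(Ω, ℝ)) :
    mulDist φ u ψ = u (mulTest φ ψ) := rfl

/-- The distribution `u` is given by integration against the function `f`. -/
def Represents (f : Eucl n → ℝ) (u : 𝓓'(Ω, ℝ)) : Prop :=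
  ∀ φ : 𝓓(Ω, ℝ), u φ = ∫ x in (Ω : Set (Eucl n)), f x * φ x

/-- Lebesgue measure on `Ω`. -/
abbrev vol (Ω : Opens (Eucl n)) : Measure (Eucl n) := volume.restrict (Ω : Set (Eucl n))

/-- The functions in `L^p(Ω)` that give the distribution `u`. They form a single almost-everywhere
class if `u` belongs to `L^p(Ω)`, and there are none otherwise. -/
def lpReps (p : ℝ) (u : 𝓓'(Ω, ℝ)) : Set (Eucl n → ℝ) :=
  {f | MemLp f (ENNReal.ofReal p) (vol Ω) ∧ Represents f u}

/-! ### Sobolev–Slobodeckij norms, as functions on `D'(Ω)` with values in `[0, ∞]` -/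

/-- `‖u‖_{L^p(Ω)}`, which is `∞` if `u` is not in `L^p(Ω)`. -/
def lpENorm (p : ℝ) (u : 𝓓'(Ω, ℝ)) : ℝ≥0∞ :=
  ⨅ f ∈ lpReps p u, eLpNorm f (ENNReal.ofReal p) (vol Ω)

/-- The Slobodeckij seminorm
`|u|_{W^{θ,p}(Ω)} = (∬_{Ω×Ω} |u(x) - u(y)|^p / |x - y|^{n + θp} dx dy)^{1/p}`, written as the norm
in `L^p(Ω × Ω)` of the difference quotient; it is `∞` if `u` is not in `L^p(Ω)`. -/
def slobodeckijENorm (p θ : ℝ) (u : 𝓓'(Ω, ℝ)) : ℝ≥0∞ :=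
  ⨅ f ∈ lpReps p u,
    eLpNorm (fun z : Eucl n × Eucl n => (f z.1 - f z.2) / ‖z.1 - z.2‖ ^ ((n : ℝ) / p + θ))
      (ENNReal.ofReal p) ((vol Ω).prod (vol Ω))

/-- The finite set of multi-indices `ν ∈ ℕ₀ⁿ` with `|ν| = k`. -/
def multiIndices (n k : ℕ) : Finset (Fin n → ℕ) := Finset.piAntidiag Finset.univ k

open Classical in
/-- The norm of `W^{s,p}(Ω)` for `s = k + θ ≥ 0`, with `k = ⌊s⌋` and `θ ∈ [0, 1)`:
the sum of `‖∂^ν u‖_{L^p}` over `|ν| ≤ k` and, if `θ ≠ 0`, of `|∂^ν u|_{W^{θ,p}}` over `|ν| = k`. -/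
def sobolevENormNonneg (s p : ℝ) (u : 𝓓'(Ω, ℝ)) : ℝ≥0∞ :=
  (∑ j ∈ Finset.range (⌊s⌋₊ + 1), ∑ ν ∈ multiIndices n j, lpENorm p (partialD Ω ν u)) +
    if Int.fract s = 0 then 0
    else ∑ ν ∈ multiIndices n ⌊s⌋₊, slobodeckijENorm p (Int.fract s) (partialD Ω ν u)

theorem one_le_ofReal {p : ℝ} (hp : 1 < p) : 1 ≤ ENNReal.ofReal p :=
  ENNReal.one_le_ofReal.2 hp.le

theorem lpReps_zero {p : ℝ} : (0 : Eucl n → ℝ) ∈ lpReps p (0 : 𝓓'(Ω, ℝ)) :=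
  ⟨MemLp.zero, fun φ => by simp⟩

theorem lpReps_smul {p : ℝ} {u : 𝓓'(Ω, ℝ)} {f : Eucl n → ℝ} (hf : f ∈ lpReps p u) (c : ℝ) :
    c • f ∈ lpReps p (c • u) := by
  refine ⟨hf.1.const_smul c, fun φ => ?_⟩
  have h := hf.2 φ
  change c * u φ = _
  rw [h, ← integral_const_mul]
  simp [mul_assoc]

theorem integrable_mul_test {p : ℝ} (hp : 1 < p) {f : Eucl n → ℝ}
    (hf : MemLp f (ENNReal.ofReal p) (vol Ω)) (φ : 𝓓(Ω, ℝ)) :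
    Integrable (fun x => f x * φ x) (vol Ω) := by
  have hloc : LocallyIntegrable f (vol Ω) :=
    hf.locallyIntegrable (one_le_ofReal hp)
  have h := hloc.integrable_smul_left_of_hasCompactSupport φ.continuous φ.hasCompactSupport
  simpa [mul_comm] using h

theorem lpReps_add {p : ℝ} (hp : 1 < p) {u v : 𝓓'(Ω, ℝ)} {f g : Eucl n → ℝ}
    (hf : f ∈ lpReps p u) (hg : g ∈ lpReps p v) : f + g ∈ lpReps p (u + v) := by
  refine ⟨hf.1.add hg.1, fun φ => ?_⟩
  change u φ + v φ = _
  rw [hf.2 φ, hg.2 φ, ← integral_add (integrable_mul_test hp hf.1 φ)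
    (integrable_mul_test hp hg.1 φ)]
  simp [add_mul]

theorem iInf_reps_zero {p : ℝ} {G : (Eucl n → ℝ) → ℝ≥0∞} (hG : G 0 = 0) :
    ⨅ f ∈ lpReps p (0 : 𝓓'(Ω, ℝ)), G f = 0 :=
  le_antisymm ((iInf₂_le _ lpReps_zero).trans hG.le) zero_le

theorem iInf_reps_add {p : ℝ} (hp : 1 < p) {G : (Eucl n → ℝ) → ℝ≥0∞}
    (hG : ∀ f g, MemLp f (ENNReal.ofReal p) (vol Ω) → MemLp g (ENNReal.ofReal p) (vol Ω) →
      G (f + g) ≤ G f + G g) (u v : 𝓓'(Ω, ℝ)) :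
    ⨅ f ∈ lpReps p (u + v), G f ≤ (⨅ f ∈ lpReps p u, G f) + ⨅ f ∈ lpReps p v, G f := by
  simp only [ENNReal.iInf_add, ENNReal.add_iInf, le_iInf_iff]
  intro g hg f hf
  exact (iInf₂_le _ (lpReps_add hp hf hg)).trans (hG _ _ hf.1 hg.1)

theorem iInf_reps_smul {p : ℝ} {G : (Eucl n → ℝ) → ℝ≥0∞} (hG0 : G 0 = 0)
    (hG : ∀ (c : ℝ) f, G (c • f) ≤ ‖c‖ₑ * G f) (c : ℝ) (u : 𝓓'(Ω, ℝ)) :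
    ⨅ f ∈ lpReps p (c • u), G f ≤ ‖c‖ₑ * ⨅ f ∈ lpReps p u, G f := by
  rcases eq_or_ne c 0 with rfl | hc
  · rw [zero_smul, iInf_reps_zero hG0]; exact zero_le
  · have h0 : ‖c‖ₑ ≠ 0 := by simpa using hc
    rw [ENNReal.mul_iInf_of_ne h0 (by simp)]
    refine le_iInf fun f => ?_
    rw [ENNReal.mul_iInf_of_ne h0 (by simp)]
    exact le_iInf fun hf => (iInf₂_le _ (lpReps_smul hf c)).trans (hG c f)

theorem lpENorm_zero {p : ℝ} : lpENorm p (0 : 𝓓'(Ω, ℝ)) = 0 := iInf_reps_zero (by simp)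

theorem lpENorm_add {p : ℝ} (hp : 1 < p) (u v : 𝓓'(Ω, ℝ)) :
    lpENorm p (u + v) ≤ lpENorm p u + lpENorm p v :=
  iInf_reps_add (G := fun f => eLpNorm f (ENNReal.ofReal p) (vol Ω)) hp
    (fun _ _ hf hg => eLpNorm_add_le hf.1 hg.1 (one_le_ofReal hp)) u v

theorem lpENorm_smul {p : ℝ} (c : ℝ) (u : 𝓓'(Ω, ℝ)) :
    lpENorm p (c • u) ≤ ‖c‖ₑ * lpENorm p u :=
  iInf_reps_smul (G := fun f => eLpNorm f (ENNReal.ofReal p) (vol Ω)) (by simp)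
    (fun c f => (eLpNorm_const_smul c f _ _).le) c u

theorem slobodeckijENorm_zero {p θ : ℝ} : slobodeckijENorm p θ (0 : 𝓓'(Ω, ℝ)) = 0 :=
  iInf_reps_zero (by simp)

theorem aestronglyMeasurable_quotient {f : Eucl n → ℝ} (hf : AEStronglyMeasurable f (vol Ω))
    (r : ℝ) : AEStronglyMeasurable
      (fun z : Eucl n × Eucl n => (f z.1 - f z.2) / ‖z.1 - z.2‖ ^ r) ((vol Ω).prod (vol Ω)) := by
  have hm : Measurable fun z : Eucl n × Eucl n => ‖z.1 - z.2‖ ^ r := by fun_prop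
  exact (hf.comp_fst.sub hf.comp_snd).div₀ hm.aestronglyMeasurable

theorem slobodeckijENorm_add {p θ : ℝ} (hp : 1 < p) (u v : 𝓓'(Ω, ℝ)) :
    slobodeckijENorm p θ (u + v) ≤ slobodeckijENorm p θ u + slobodeckijENorm p θ v := by
  refine iInf_reps_add hp (fun f g hf hg => ?_) u v
  refine le_trans (le_of_eq ?_) (eLpNorm_add_le (aestronglyMeasurable_quotient hf.1 _)
    (aestronglyMeasurable_quotient hg.1 _) (one_le_ofReal hp))
  congr 1
  ext z
  simp only [Pi.add_apply]
  ring

theorem slobodeckijENorm_smul {p θ : ℝ} (c : ℝ) (u : 𝓓'(Ω, ℝ)) :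
    slobodeckijENorm p θ (c • u) ≤ ‖c‖ₑ * slobodeckijENorm p θ u := by
  refine iInf_reps_smul (by simp) (fun c f => ?_) c u
  refine le_trans (le_of_eq ?_) (eLpNorm_const_smul c _ _ _).le
  congr 1
  ext z
  simp only [Pi.smul_apply, smul_eq_mul]
  ring

theorem sobolevENormNonneg_zero {s p : ℝ} : sobolevENormNonneg s p (0 : 𝓓'(Ω, ℝ)) = 0 := by
  simp [sobolevENormNonneg, lpENorm_zero, slobodeckijENorm_zero]

theorem sobolevENormNonneg_add {s p : ℝ} (hp : 1 < p) (u v : 𝓓'(Ω, ℝ)) :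
    sobolevENormNonneg s p (u + v) ≤ sobolevENormNonneg s p u + sobolevENormNonneg s p v := by
  unfold sobolevENormNonneg
  rw [add_add_add_comm]
  refine add_le_add ?_ ?_
  · simp only [← Finset.sum_add_distrib, map_add]
    exact Finset.sum_le_sum fun j _ => Finset.sum_le_sum fun ν _ => lpENorm_add hp _ _
  · split_ifs
    · simp
    · simp only [← Finset.sum_add_distrib, map_add]
      exact Finset.sum_le_sum fun ν _ => slobodeckijENorm_add hp _ _

theorem sobolevENormNonneg_smul {s p : ℝ} (c : ℝ) (u : 𝓓'(Ω, ℝ)) :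
    sobolevENormNonneg s p (c • u) ≤ ‖c‖ₑ * sobolevENormNonneg s p u := by
  unfold sobolevENormNonneg
  rw [mul_add]
  refine add_le_add ?_ ?_
  · simp only [Finset.mul_sum, map_smul]
    exact Finset.sum_le_sum fun j _ => Finset.sum_le_sum fun ν _ => lpENorm_smul _ _
  · split_ifs
    · simp
    · simp only [Finset.mul_sum, map_smul]
      exact Finset.sum_le_sum fun ν _ => slobodeckijENorm_smul _ _

/-- `W₀^{s,p}(Ω)` for `s ≥ 0`: the closure of `C_c^∞(Ω)` in `W^{s,p}(Ω)`, as a space of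
distributions. -/
def SobolevZero (s p : ℝ) (hp : 1 < p) (Ω : Opens (Eucl n)) : Submodule ℝ 𝓓'(Ω, ℝ) where
  carrier := {u | sobolevENormNonneg s p u < ∞ ∧ ∀ ε : ℝ≥0∞, 0 < ε →
    ∃ (φ : 𝓓(Ω, ℝ)) (v : 𝓓'(Ω, ℝ)), Represents φ v ∧ sobolevENormNonneg s p (u - v) < ε}
  zero_mem' := by
    refine ⟨by simp [sobolevENormNonneg_zero], fun ε hε => ⟨0, 0, fun φ => by simp, ?_⟩⟩
    rwa [sub_zero, sobolevENormNonneg_zero]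
  add_mem' := by
    rintro u v ⟨hu, hu'⟩ ⟨hv, hv'⟩
    refine ⟨(sobolevENormNonneg_add hp u v).trans_lt (ENNReal.add_lt_top.2 ⟨hu, hv⟩),
      fun ε hε => ?_⟩
    obtain ⟨φ, a, ha, ha'⟩ := hu' (ε / 2) (ENNReal.half_pos hε.ne')
    obtain ⟨ψ, b, hb, hb'⟩ := hv' (ε / 2) (ENNReal.half_pos hε.ne')
    refine ⟨φ + ψ, a + b, fun χ => ?_, ?_⟩
    · change a χ + b χ = _
      have hint : ∀ η : 𝓓(Ω, ℝ), Integrable (fun x => η x * χ x) (vol Ω) := fun η =>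
        ((η.continuous.mul χ.continuous).integrable_of_hasCompactSupport
          χ.hasCompactSupport.mul_left).restrict
      rw [ha χ, hb χ, ← integral_add (hint φ) (hint ψ)]
      simp [add_mul]
    · rw [add_sub_add_comm]
      calc _ ≤ _ := sobolevENormNonneg_add hp _ _
        _ < ε / 2 + ε / 2 := ENNReal.add_lt_add ha' hb'
        _ = ε := ENNReal.add_halves ε
  smul_mem' := by
    rintro c u ⟨hu, hu'⟩
    refine ⟨(sobolevENormNonneg_smul c u).trans_lt (ENNReal.mul_lt_top (by simp) hu),
      fun ε hε => ?_⟩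
    rcases eq_or_ne c 0 with rfl | hc
    · refine ⟨0, 0, fun φ => by simp, ?_⟩
      rwa [zero_smul, sub_zero, sobolevENormNonneg_zero]
    have h0 : ‖c‖ₑ ≠ 0 := by simpa using hc
    obtain ⟨φ, a, ha, ha'⟩ := hu' (ε / ‖c‖ₑ) (ENNReal.div_pos hε.ne' (by simp))
    refine ⟨c • φ, c • a, fun χ => ?_, ?_⟩
    · change c * a χ = _
      rw [ha χ, ← integral_const_mul]
      simp [mul_assoc]
    · rw [← smul_sub]
      refine (sobolevENormNonneg_smul c _).trans_lt ?_
      rw [mul_comm]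
      exact (ENNReal.lt_div_iff_mul_lt (Or.inl h0) (Or.inl (by simp))).1 ha'

/-- `F` is a bounded linear functional on `W₀^{s,p}(Ω)`, with constant `C`, whose restriction to
`C_c^∞(Ω)` is the distribution `u`. -/
def ExtendsWithBound {s p : ℝ} {hp : 1 < p} (F : SobolevZero s p hp Ω →ₗ[ℝ] ℝ) (C : ℝ≥0)
    (u : 𝓓'(Ω, ℝ)) : Prop :=
  (∀ f : SobolevZero s p hp Ω, ‖F f‖ₑ ≤ C * sobolevENormNonneg s p (f : 𝓓'(Ω, ℝ))) ∧
    ∀ (f : SobolevZero s p hp Ω) (φ : 𝓓(Ω, ℝ)), Represents φ (f : 𝓓'(Ω, ℝ)) → F f = u φ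

theorem one_lt_conj {p : ℝ} (hp : 1 < p) : 1 < p.conjExponent :=
  (Real.HolderConjugate.conjExponent hp).symm.lt

/-- The norm of `W^{s,p}(Ω) = (W₀^{-s,p'}(Ω))^*`, `1/p + 1/p' = 1`, for `s < 0`: the operator norm
of the bounded functional on `W₀^{-s,p'}(Ω)` that extends `u`, and `∞` if there is none. -/
def sobolevENormNeg (s p : ℝ) (hp : 1 < p) (u : 𝓓'(Ω, ℝ)) : ℝ≥0∞ :=
  ⨅ (C : ℝ≥0) (_ : ∃ F : SobolevZero (-s) p.conjExponent (one_lt_conj hp) Ω →ₗ[ℝ] ℝ,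
    ExtendsWithBound F C u), (C : ℝ≥0∞)

theorem sobolevENormNeg_zero {s p : ℝ} (hp : 1 < p) :
    sobolevENormNeg s p hp (0 : 𝓓'(Ω, ℝ)) = 0 := by
  refine le_antisymm ((iInf₂_le (0 : ℝ≥0) ⟨0, ?_, ?_⟩).trans (by simp)) zero_le
  · intro f; simp
  · intro f φ _; rfl

theorem sobolevENormNeg_add {s p : ℝ} (hp : 1 < p) (u v : 𝓓'(Ω, ℝ)) :
    sobolevENormNeg s p hp (u + v) ≤ sobolevENormNeg s p hp u + sobolevENormNeg s p hp v := by
  unfold sobolevENormNeg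
  simp only [ENNReal.iInf_add, ENNReal.add_iInf, le_iInf_iff]
  rintro D ⟨G, hG, hG'⟩ C ⟨F, hF, hF'⟩
  rw [← ENNReal.coe_add]
  refine iInf₂_le _ ⟨F + G, fun f => ?_, fun f φ h => ?_⟩
  · rw [ENNReal.coe_add, add_mul, LinearMap.add_apply]
    refine (enorm_add_le _ _).trans ?_
    exact add_le_add (hF f) (hG f)
  · rw [LinearMap.add_apply, hF' f φ h, hG' f φ h]
    rfl

theorem sobolevENormNeg_smul {s p : ℝ} (hp : 1 < p) (c : ℝ) (u : 𝓓'(Ω, ℝ)) :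
    sobolevENormNeg s p hp (c • u) ≤ ‖c‖ₑ * sobolevENormNeg s p hp u := by
  rcases eq_or_ne c 0 with rfl | hc
  · rw [zero_smul, sobolevENormNeg_zero]; exact zero_le
  have h0 : ‖c‖ₑ ≠ 0 := by simpa using hc
  unfold sobolevENormNeg
  rw [ENNReal.mul_iInf_of_ne h0 (by simp)]
  refine le_iInf fun C => ?_
  rw [ENNReal.mul_iInf_of_ne h0 (by simp)]
  refine le_iInf ?_
  rintro ⟨F, hF, hF'⟩
  have e : ‖c‖ₑ * (C : ℝ≥0∞) = ((‖c‖₊ * C : ℝ≥0) : ℝ≥0∞) := by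
    rw [ENNReal.coe_mul]; rfl
  rw [e]
  refine iInf₂_le _ ⟨c • F, fun f => ?_, fun f φ h => ?_⟩
  · rw [← e, LinearMap.smul_apply, smul_eq_mul, enorm_mul, mul_assoc]
    exact mul_le_mul_right (hF f) _
  · rw [LinearMap.smul_apply, hF' f φ h]; rfl

open Classical in
/-- The norm of `W^{s,p}(Ω)` for real `s`, as a function on `D'(Ω)` with values in `[0, ∞]`. -/
def sobolevENorm (s p : ℝ) (hp : 1 < p) (u : 𝓓'(Ω, ℝ)) : ℝ≥0∞ :=
  if 0 ≤ s then sobolevENormNonneg s p u else sobolevENormNeg s p hp u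

theorem sobolevENorm_zero {s p : ℝ} (hp : 1 < p) : sobolevENorm s p hp (0 : 𝓓'(Ω, ℝ)) = 0 := by
  unfold sobolevENorm
  split_ifs
  exacts [sobolevENormNonneg_zero, sobolevENormNeg_zero hp]

theorem sobolevENorm_add {s p : ℝ} (hp : 1 < p) (u v : 𝓓'(Ω, ℝ)) :
    sobolevENorm s p hp (u + v) ≤ sobolevENorm s p hp u + sobolevENorm s p hp v := by
  unfold sobolevENorm
  split_ifs
  exacts [sobolevENormNonneg_add hp u v, sobolevENormNeg_add hp u v]

theorem sobolevENorm_smul {s p : ℝ} (hp : 1 < p) (c : ℝ) (u : 𝓓'(Ω, ℝ)) :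
    sobolevENorm s p hp (c • u) ≤ ‖c‖ₑ * sobolevENorm s p hp u := by
  unfold sobolevENorm
  split_ifs
  exacts [sobolevENormNonneg_smul c u, sobolevENormNeg_smul hp c u]

/-- The Sobolev–Slobodeckij space `W^{s,p}(Ω)`, `s ∈ ℝ`, as a space of distributions. -/
def Sobolev (s p : ℝ) (hp : 1 < p) (Ω : Opens (Eucl n)) : Submodule ℝ 𝓓'(Ω, ℝ) where
  carrier := {u | sobolevENorm s p hp u < ∞}
  zero_mem' := by simp [sobolevENorm_zero]
  add_mem' {u v} hu hv := (sobolevENorm_add hp u v).trans_lt (ENNReal.add_lt_top.2 ⟨hu, hv⟩)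
  smul_mem' c u hu := (sobolevENorm_smul hp c u).trans_lt (ENNReal.mul_lt_top (by simp) hu)

/-! ### Locally Sobolev spaces -/

/-- The vector space `{u ∈ D'(Ω) : φ u ∈ W^{s,p}(Ω) for all φ ∈ C_c^∞(Ω)}`. -/
def locSobolevSubmodule (s p : ℝ) (hp : 1 < p) (Ω : Opens (Eucl n)) : Submodule ℝ 𝓓'(Ω, ℝ) :=
  ⨅ φ : 𝓓(Ω, ℝ), (Sobolev s p hp Ω).comap (mulDist φ).toLinearMap

theorem mem_locSobolevSubmodule {s p : ℝ} {hp : 1 < p} {u : 𝓓'(Ω, ℝ)} :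
    u ∈ locSobolevSubmodule s p hp Ω ↔ ∀ φ : 𝓓(Ω, ℝ), mulDist φ u ∈ Sobolev s p hp Ω := by
  simp [locSobolevSubmodule, Submodule.mem_iInf]

/-- The locally Sobolev space `W^{s,p}_loc(Ω)`. This is a separate type, so that its topology is
the one of the seminorms `u ↦ ‖φ u‖_{W^{s,p}(Ω)}` below and not the subspace topology of `D'(Ω)`. -/
def LocSobolev (s p : ℝ) (hp : 1 < p) (Ω : Opens (Eucl n)) : Type :=
  locSobolevSubmodule s p hp Ω

namespace LocSobolev

variable {s p : ℝ} {hp : 1 < p}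

instance : AddCommGroup (LocSobolev s p hp Ω) :=
  inferInstanceAs (AddCommGroup (locSobolevSubmodule s p hp Ω))

instance : Module ℝ (LocSobolev s p hp Ω) :=
  inferInstanceAs (Module ℝ (locSobolevSubmodule s p hp Ω))

/-- The inclusion `W^{s,p}_loc(Ω) ⊆ D'(Ω)`. -/
def toDistribution : LocSobolev s p hp Ω →ₗ[ℝ] 𝓓'(Ω, ℝ) :=
  (locSobolevSubmodule s p hp Ω).subtype

theorem sobolevENorm_mulDist_lt_top (u : LocSobolev s p hp Ω) (φ : 𝓓(Ω, ℝ)) :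
    sobolevENorm s p hp (mulDist φ (toDistribution u)) < ∞ :=
  mem_locSobolevSubmodule.1 u.2 φ

/-- The seminorm `|u|_φ = ‖φ u‖_{W^{s,p}(Ω)}` on `W^{s,p}_loc(Ω)`, for `φ ∈ C_c^∞(Ω)`. -/
def seminorm (s p : ℝ) (hp : 1 < p) (Ω : Opens (Eucl n)) :
    SeminormFamily ℝ (LocSobolev s p hp Ω) 𝓓(Ω, ℝ) := fun φ =>
  Seminorm.ofSMulLE (fun u => (sobolevENorm s p hp (mulDist φ (toDistribution u))).toReal)
    (by simp [sobolevENorm_zero])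
    (fun u v => by
      have hu := (sobolevENorm_mulDist_lt_top u φ).ne
      have hv := (sobolevENorm_mulDist_lt_top v φ).ne
      rw [← ENNReal.toReal_add hu hv, map_add, map_add]
      exact ENNReal.toReal_mono (ENNReal.add_ne_top.2 ⟨hu, hv⟩) (sobolevENorm_add hp _ _))
    (fun c u => by
      have hu := (sobolevENorm_mulDist_lt_top u φ).ne
      rw [map_smul, map_smul]
      refine (ENNReal.toReal_mono (ENNReal.mul_ne_top (by simp) hu)
        (sobolevENorm_smul hp c _)).trans (le_of_eq ?_)
      rw [ENNReal.toReal_mul]; simp)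

theorem seminorm_apply (φ : 𝓓(Ω, ℝ)) (u : LocSobolev s p hp Ω) :
    seminorm s p hp Ω φ u = (sobolevENorm s p hp (mulDist φ (toDistribution u))).toReal := rfl

/-- The natural topology of `W^{s,p}_loc(Ω)`, induced by the seminorms `|·|_φ`. -/
instance : TopologicalSpace (LocSobolev s p hp Ω) :=
  (seminorm s p hp Ω).moduleFilterBasis.topology

theorem withSeminorms : WithSeminorms (seminorm s p hp Ω) := ⟨rfl⟩

end LocSobolev

/-- The operator `∂^α : W^{s,p}_loc(Ω) → W^{s-|α|,p}_loc(Ω)` is well defined and continuous: the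
distributional derivative `∂^α` maps the first space into the second, and the resulting linear map
is continuous for their natural topologies. -/
def DerivWellDefinedContinuous (s p : ℝ) (hp : 1 < p) (α : Fin n → ℕ) (Ω : Opens (Eucl n)) :
    Prop :=
  ∃ T : LocSobolev s p hp Ω →L[ℝ] LocSobolev (s - ((∑ i, α i : ℕ) : ℝ)) p hp Ω,
    ∀ u : LocSobolev s p hp Ω,
      LocSobolev.toDistribution (T u) = partialD Ω α (LocSobolev.toDistribution u)

/-- The open set `Ω` has Lipschitz continuous boundary: near each boundary point, for some unit
vector `e`, `Ω` is the set of points `x` that lie strictly above, in the direction `e`, the graph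
of a Lipschitz function on the hyperplane orthogonal to `e`. -/
def HasLipschitzBoundary (Ω : Opens (Eucl n)) : Prop :=
  ∀ x₀ ∈ frontier (Ω : Set (Eucl n)), ∃ (e : Eucl n) (g : (ℝ ∙ e)ᗮ → ℝ) (K : ℝ≥0) (r : ℝ),
    ‖e‖ = 1 ∧ LipschitzWith K g ∧ 0 < r ∧
      ∀ x ∈ Metric.ball x₀ r, x ∈ Ω ↔ g ((ℝ ∙ e)ᗮ.orthogonalProjectionOnto x) < inner ℝ e x

end LocSob

end

noncomputable section

namespace LocSob

variable {n : ℕ} {Ω : Opens (Eucl n)}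

/-! ### The modulus of continuity in `L^p(ℝⁿ)` -/

/-! Peeling off one derivative at a time reduces everything to a single `∂ᵢ`. If `χ = 1` on the
support of `φ`, then `φ ∂ᵢ u = φ ∂ᵢ(χ u)`, so it is enough to bound `v ↦ φ ∂ᵢ v` from `W^{s,p}(Ω)`
to `W^{s-1,p}(Ω)` (`exists_sobolevENorm_mulDist_distDeriv_le`). The cut-off keeps all supports in a
compact subset of `Ω`, so the fractional estimates can be made on the whole of `ℝⁿ` with functions
extended by zero. There are three ranges of `s`.

For `s ≥ 1` both orders are nonnegative: `∂ᵢ` lowers the order by one by the definition of the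
norms, and multiplication by `φ` is bounded on spaces of nonnegative order. For `s ≤ 0` the estimate
is the dual one. By Hahn–Banach the norm of negative order is the best constant in `|u(ψ)| ≤ A ‖ψ‖`
over test functions, and `ψ ↦ ∂ᵢ(φ ψ)` is bounded from order `1 - s` to order `-s`.

The critical range is `0 < s < 1`, where the order changes sign. What is needed is `|∫ f ∂ₑg| ≤ C
‖f‖_{W^{s,p}} ‖g‖_{W^{1-s,p'}}` (`exists_integral_lineDeriv_le`). Replace `∂ₑg` by the difference
quotient at scale `t = 2^{-j}`. Halving `t` changes the pairing by `t⁻¹` times an integral of a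
difference of `f` against a difference of `g`. Write `t⁻¹ = t^{-s} t^{-(1-s)}`, then use Hölder's
inequality in `x` and in `j`. The two resulting sums of `L^p` moduli of continuity at the points
`2^{-j} e` are bounded by the Slobodeckij seminorms (`exists_sum_translModulus_le`).

Multiplication on spaces of fractional order uses the Leibniz rule. Terms in which some derivative
falls on `φ` leave a derivative of `u` of less than top order, which still has weak first
derivatives in `L^p`; after cut-off it therefore has finite Slobodeckij seminorm of every order
below `1`. -/

/-- The translation modulus `w ↦ ‖f(· + w) - f‖_p^p`. -/
def translModulus (p : ℝ) (f : Eucl n → ℝ) (w : Eucl n) : ℝ≥0∞ :=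
  ∫⁻ x, ‖f (x + w) - f x‖ₑ ^ p

/-- The kernel `|w|^{-(n + θp)}`. -/
def gagliardoKernel (p θ : ℝ) (w : Eucl n) : ℝ≥0∞ :=
  ENNReal.ofReal (‖w‖ ^ (-((n : ℝ) + θ * p)))

/-- The `p`-th power of the Slobodeckij seminorm on `ℝⁿ`. -/
def gagliardo (p θ : ℝ) (f : Eucl n → ℝ) : ℝ≥0∞ :=
  ∫⁻ w, translModulus p f w * gagliardoKernel p θ w

theorem measurable_gagliardoKernel (p θ : ℝ) :
    Measurable (gagliardoKernel p θ : Eucl n → ℝ≥0∞) := by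
  unfold gagliardoKernel
  fun_prop

theorem gagliardoKernel_neg (p θ : ℝ) (w : Eucl n) :
    gagliardoKernel p θ (-w) = gagliardoKernel p θ w := by
  simp [gagliardoKernel]

theorem measurable_translModulus {p : ℝ} {f : Eucl n → ℝ} (hf : Measurable f) :
    Measurable (translModulus p f) := by
  unfold translModulus
  have : Measurable fun z : Eucl n × Eucl n => ‖f (z.2 + z.1) - f z.2‖ₑ ^ p := by fun_prop
  exact this.lintegral_prod_right'

/-- Substitute `(x, y) = (x, x + w)`, which preserves the product measure, and integrate in `x`
first; the kernel is even. -/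
theorem lintegral_gagliardo {p θ : ℝ} {f : Eucl n → ℝ} (hf : Measurable f) :
    ∫⁻ z : Eucl n × Eucl n, ‖f z.1 - f z.2‖ₑ ^ p * gagliardoKernel p θ (z.1 - z.2)
      ∂(volume.prod volume) = gagliardo p θ f := by
  have hk := measurable_gagliardoKernel (n := n) p θ
  rw [← (measurePreserving_prod_add (volume : Measure (Eucl n)) volume).lintegral_comp
    (by fun_prop), lintegral_prod_symm' _ (by fun_prop)]
  unfold gagliardo
  refine lintegral_congr fun w => ?_
  rw [translModulus, ← lintegral_mul_const _ (by fun_prop)]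
  refine lintegral_congr fun x => ?_
  simp only [sub_add_cancel_left, gagliardoKernel_neg, enorm_sub_rev]

theorem enorm_add_rpow_le {p : ℝ} (hp : 1 ≤ p) (a b : ℝ) :
    ‖a + b‖ₑ ^ p ≤ 2 ^ p * (‖a‖ₑ ^ p + ‖b‖ₑ ^ p) := by
  calc ‖a + b‖ₑ ^ p ≤ (‖a‖ₑ + ‖b‖ₑ) ^ p :=
        ENNReal.rpow_le_rpow (enorm_add_le a b) (by linarith)
    _ ≤ 2 ^ (p - 1) * (‖a‖ₑ ^ p + ‖b‖ₑ ^ p) := ENNReal.rpow_add_le_mul_rpow_add_rpow _ _ hp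
    _ ≤ 2 ^ p * (‖a‖ₑ ^ p + ‖b‖ₑ ^ p) := by
        gcongr
        · norm_num
        · linarith

theorem enorm_sub_rpow_le {p : ℝ} (hp : 1 ≤ p) (a b : ℝ) :
    ‖a - b‖ₑ ^ p ≤ 2 ^ p * (‖a‖ₑ ^ p + ‖b‖ₑ ^ p) := by
  simpa [sub_eq_add_neg] using enorm_add_rpow_le hp a (-b)

theorem translModulus_le_norm {p : ℝ} (hp : 1 ≤ p) {f : Eucl n → ℝ} (hf : Measurable f)
    (w : Eucl n) : translModulus p f w ≤ 2 ^ p * (2 * ∫⁻ x, ‖f x‖ₑ ^ p) := by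
  unfold translModulus
  calc _ ≤ ∫⁻ x, 2 ^ p * (‖f (x + w)‖ₑ ^ p + ‖f x‖ₑ ^ p) :=
        lintegral_mono fun x => enorm_sub_rpow_le hp _ _
    _ = _ := by
      rw [lintegral_const_mul _ (by fun_prop), lintegral_add_right _ (by fun_prop),
        lintegral_add_right_eq_self (fun x => ‖f x‖ₑ ^ p) w, two_mul]

theorem translModulus_neg {p : ℝ} (f : Eucl n → ℝ) (w : Eucl n) :
    translModulus p f (-w) = translModulus p f w := by
  unfold translModulus
  rw [← lintegral_add_right_eq_self _ w]
  simp [enorm_sub_rev]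

/-- Pass from `x` to `x + h` through `x + w`; translation invariance turns the second step into the
modulus at `h - w`. -/
theorem translModulus_le_add {p : ℝ} (hp : 1 ≤ p) {f : Eucl n → ℝ} (hf : Measurable f)
    (h w : Eucl n) :
    translModulus p f h ≤ 2 ^ p * (translModulus p f w + translModulus p f (h - w)) := by
  have e : translModulus p f (h - w) = ∫⁻ x, ‖f (x + h) - f (x + w)‖ₑ ^ p := by
    unfold translModulus
    rw [← lintegral_add_right_eq_self _ w]
    simp [add_assoc]
  rw [e]
  unfold translModulus
  rw [← lintegral_add_right _ (by fun_prop), ← lintegral_const_mul _ (by fun_prop)]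
  refine lintegral_mono fun x => ?_
  rw [add_comm (‖f (x + w) - f x‖ₑ ^ p)]
  simpa using enorm_add_rpow_le hp (f (x + h) - f (x + w)) (f (x + w) - f x)

/-- Integrate `translModulus_le_add` over the ball. The reflection `w ↦ h - w` fixes its centre `h /
2` and preserves the ball, so both terms contribute equally. A value at one point is thus controlled
by an average. -/
theorem translModulus_mul_volume_ball_le {p : ℝ} (hp : 1 ≤ p) {f : Eucl n → ℝ}
    (hf : Measurable f) (h : Eucl n) (r : ℝ) :
    translModulus p f h * volume (Metric.ball ((1 / 2 : ℝ) • h) r) ≤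
      2 ^ p * (2 * ∫⁻ w in Metric.ball ((1 / 2 : ℝ) • h) r, translModulus p f w) := by
  set B := Metric.ball ((1 / 2 : ℝ) • h) r
  have hB : MeasurableSet B := measurableSet_ball
  have hω := measurable_translModulus (p := p) hf
  have hrefl : ∫⁻ w in B, translModulus p f (h - w) = ∫⁻ w in B, translModulus p f w := by
    rw [← lintegral_indicator hB, ← lintegral_indicator hB,
      ← lintegral_sub_left_eq_self (fun w => B.indicator (translModulus p f) w) h]
    refine lintegral_congr fun w => ?_
    have : h - w ∈ B ↔ w ∈ B := by
      simp only [B, Metric.mem_ball, dist_eq_norm]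
      rw [← norm_neg (w - _)]
      have : h - w - (1 / 2 : ℝ) • h = -(w - (1 / 2 : ℝ) • h) := by
        have : h = (1 / 2 : ℝ) • h + (1 / 2 : ℝ) • h := by rw [← add_smul]; norm_num
        nth_rewrite 1 [this]
        abel
      rw [this]
    by_cases hw : w ∈ B <;> simp [hw, this]
  calc _ = ∫⁻ w in B, translModulus p f h := by simp
    _ ≤ ∫⁻ w in B, 2 ^ p * (translModulus p f w + translModulus p f (h - w)) :=
        lintegral_mono fun w => translModulus_le_add hp hf h w
    _ = _ := by
      rw [lintegral_const_mul _ (by fun_prop), lintegral_add_left hω, hrefl, two_mul]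

/-- The ball of radius `t / 8` around the midpoint of `0` and `t e`. -/
def midBall (e : Eucl n) (t : ℝ) : Set (Eucl n) := Metric.ball ((1 / 2 : ℝ) • t • e) (t / 8)

theorem norm_of_mem_midBall {e : Eucl n} (he : ‖e‖ = 1) {t : ℝ} (ht : 0 < t) {w : Eucl n}
    (hw : w ∈ midBall e t) : 3 / 8 * t < ‖w‖ ∧ ‖w‖ < 5 / 8 * t := by
  rw [midBall, Metric.mem_ball, dist_eq_norm] at hw
  have hn : ‖(1 / 2 : ℝ) • t • e‖ = t / 2 := by
    rw [norm_smul, norm_smul, he, Real.norm_of_nonneg ht.le]; norm_num; ring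
  have h1 := norm_sub_norm_le w ((1 / 2 : ℝ) • t • e)
  have h2 := norm_sub_norm_le ((1 / 2 : ℝ) • t • e) w
  rw [norm_sub_rev] at h2
  constructor <;> linarith

/-- On `midBall e t` one has `0 < ‖w‖ < t`, so the kernel is at least `t^{-(n + θp)}`. The volume of
the ball is a constant times `t^n`, which leaves the weight `t^{-θp}`. -/
theorem exists_scaled_translModulus_le {p θ : ℝ} (hp : 1 ≤ p) (hθ : 0 < θ) :
    ∃ C : ℝ≥0, ∀ f : Eucl n → ℝ, Measurable f → ∀ e : Eucl n, ‖e‖ = 1 → ∀ t : ℝ, 0 < t →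
      ENNReal.ofReal (t ^ (-(θ * p))) * translModulus p f (t • e) ≤
        C * ∫⁻ w in midBall e t, translModulus p f w * gagliardoKernel p θ w := by
  set c : ℝ≥0∞ := ENNReal.ofReal ((1 / 8) ^ n) * volume (Metric.ball (0 : Eucl n) 1) with hc
  have hc0 : c ≠ 0 := mul_ne_zero (by simp) (Metric.measure_ball_pos _ _ one_pos).ne'
  have hct : c ≠ ∞ := ENNReal.mul_ne_top (by simp) measure_ball_lt_top.ne
  have hCt : c⁻¹ * (2 ^ p * 2) ≠ ∞ := ENNReal.mul_ne_top (by simpa using hc0)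
    (ENNReal.mul_ne_top (ENNReal.rpow_ne_top_of_nonneg (by linarith) (by simp)) (by simp))
  refine ⟨(c⁻¹ * (2 ^ p * 2)).toNNReal, fun f hf e he t ht => ?_⟩
  rw [ENNReal.coe_toNNReal hCt]
  have hvol : volume (midBall e t) = ENNReal.ofReal (t ^ n) * c := by
    rw [midBall, Measure.addHaar_ball_of_pos _ _ (by positivity), hc, ← mul_assoc,
      ← ENNReal.ofReal_mul (by positivity)]
    congr 2
    simp [div_eq_mul_inv, mul_pow]
  have hω := measurable_translModulus (p := p) hf
  have key := translModulus_mul_volume_ball_le hp hf (t • e) (t / 8)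
  change _ * volume (midBall e t) ≤ 2 ^ p * (2 * ∫⁻ w in midBall e t, _) at key
  have hker : ∀ w ∈ midBall e t, ENNReal.ofReal (t ^ (-((n : ℝ) + θ * p))) ≤
      gagliardoKernel p θ w := by
    intro w hw
    have := norm_of_mem_midBall he ht hw
    refine ENNReal.ofReal_le_ofReal ?_
    refine Real.rpow_le_rpow_of_nonpos (by linarith) (by linarith) ?_
    have : 0 < θ * p := by positivity
    have : (0 : ℝ) ≤ n := by positivity
    linarith
  have hpow : ENNReal.ofReal (t ^ (-((n : ℝ) + θ * p))) * ENNReal.ofReal (t ^ n) =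
      ENNReal.ofReal (t ^ (-(θ * p))) := by
    rw [← ENNReal.ofReal_mul (by positivity), ← Real.rpow_natCast, ← Real.rpow_add ht]
    congr 2
    ring
  rw [hvol] at key
  calc ENNReal.ofReal (t ^ (-(θ * p))) * translModulus p f (t • e)
      = c⁻¹ * (ENNReal.ofReal (t ^ (-((n : ℝ) + θ * p))) *
          (translModulus p f (t • e) * (ENNReal.ofReal (t ^ n) * c))) := by
        rw [← hpow]
        calc _ = (c⁻¹ * c) * (ENNReal.ofReal (t ^ (-((n : ℝ) + θ * p))) *
              ENNReal.ofReal (t ^ n) * translModulus p f (t • e)) := by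
                rw [ENNReal.inv_mul_cancel hc0 hct, one_mul]
          _ = _ := by ring
    _ ≤ c⁻¹ * (ENNReal.ofReal (t ^ (-((n : ℝ) + θ * p))) *
          (2 ^ p * (2 * ∫⁻ w in midBall e t, translModulus p f w))) := by gcongr
    _ = c⁻¹ * (2 ^ p * 2) * ∫⁻ w in midBall e t,
          translModulus p f w * ENNReal.ofReal (t ^ (-((n : ℝ) + θ * p))) := by
        rw [lintegral_mul_const _ hω]; ring
    _ ≤ _ := by
        gcongr _ * ?_
        exact setLIntegral_mono' measurableSet_ball fun w hw => by gcongr; exact hker w hw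

/-- The ball at scale `t` lies in the shell `3t/8 < ‖w‖ < 5t/8`. Shells at distinct dyadic scales
are disjoint because `5/8 · 1/2 < 3/8`; this is why the radius is as small as `t / 8`. -/
theorem pairwise_disjoint_midBall {e : Eucl n} (he : ‖e‖ = 1) :
    Pairwise (Function.onFun Disjoint fun j : ℕ => midBall e ((1 / 2 : ℝ) ^ j)) := by
  have key : ∀ i j : ℕ, i < j →
      Disjoint (midBall e ((1 / 2 : ℝ) ^ i)) (midBall e ((1 / 2 : ℝ) ^ j)) := by
    intro i j hij
    rw [Set.disjoint_left]
    intro w h1 h2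
    have h1 := norm_of_mem_midBall he (by positivity) h1
    have h2 := norm_of_mem_midBall he (by positivity) h2
    have h3 : (1 / 2 : ℝ) ^ j ≤ (1 / 2) ^ (i + 1) :=
      pow_le_pow_of_le_one (by norm_num) (by norm_num) hij
    rw [pow_succ] at h3
    have : (0 : ℝ) < (1 / 2) ^ i := by positivity
    linarith
  intro i j hij
  rcases hij.lt_or_gt with h | h
  exacts [key i j h, (key j i h).symm]

/-- Each term is bounded by the Slobodeckij integral over its own ball, and the balls are disjoint.
The constant depends neither on `e` nor on `S`. -/
theorem exists_sum_translModulus_le {p θ : ℝ} (hp : 1 ≤ p) (hθ : 0 < θ) :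
    ∃ C : ℝ≥0, ∀ f : Eucl n → ℝ, Measurable f → ∀ e : Eucl n, ‖e‖ = 1 → ∀ S : Finset ℕ,
      ∑ j ∈ S, ENNReal.ofReal (((1 / 2 : ℝ) ^ j) ^ (-(θ * p))) *
        translModulus p f ((1 / 2 : ℝ) ^ j • e) ≤ C * gagliardo p θ f := by
  obtain ⟨C, hC⟩ := exists_scaled_translModulus_le (n := n) hp hθ
  refine ⟨C, fun f hf e he S => ?_⟩
  calc _ ≤ ∑ j ∈ S, C * ∫⁻ w in midBall e ((1 / 2 : ℝ) ^ j),
          translModulus p f w * gagliardoKernel p θ w :=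
        Finset.sum_le_sum fun j _ => hC f hf e he _ (by positivity)
    _ = C * ∑ j ∈ S, ∫⁻ w in midBall e ((1 / 2 : ℝ) ^ j),
          translModulus p f w * gagliardoKernel p θ w := by rw [Finset.mul_sum]
    _ ≤ C * gagliardo p θ f := by
        gcongr
        rw [← lintegral_biUnion_finset ((pairwise_disjoint_midBall he).set_pairwise _)
          (fun _ _ => measurableSet_ball)]
        exact setLIntegral_le_lintegral _ _

/-! ### The pairing of `f` with a derivative of `g`, for complementary orders of smoothness -/

theorem enorm_integral_mul_le {p q : ℝ} (hpq : p.HolderConjugate q) {a b : Eucl n → ℝ}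
    (ha : Measurable a) (hb : Measurable b) :
    ‖∫ x, a x * b x‖ₑ ≤ (∫⁻ x, ‖a x‖ₑ ^ p) ^ (1 / p) * (∫⁻ x, ‖b x‖ₑ ^ q) ^ (1 / q) := by
  refine (enorm_integral_le_lintegral_enorm _).trans ?_
  simp only [enorm_mul]
  exact ENNReal.lintegral_mul_le_Lp_mul_Lq volume hpq ha.enorm.aemeasurable hb.enorm.aemeasurable

/-- The pairing of `f` with the difference quotient of `g` in the direction `e`. -/
def diffPairing (f g : Eucl n → ℝ) (e : Eucl n) (t : ℝ) : ℝ :=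
  ∫ x, (t⁻¹ • (g (x + t • e) - g x)) * f x

theorem integrable_comp_add_mul {f g : Eucl n → ℝ} (hf : Integrable f) (hg : Continuous g)
    (hg' : HasCompactSupport g) (v : Eucl n) : Integrable fun x => g (x + v) * f x := by
  obtain ⟨M, hM⟩ := hg.bounded_above_of_compact_support hg'
  exact hf.bdd_mul (by fun_prop) (.of_forall fun x => hM (x + v))

/-- With `a = (t / 2) e`, the left side is `-t⁻¹` times the pairing of `f` with the second
difference `g(x + 2a) - 2 g(x + a) + g(x)`. Translating by `a` moves one of the two differences onto
`f`. -/
theorem diffPairing_half_sub {f g : Eucl n → ℝ} (hf : Integrable f) (hg : Continuous g)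
    (hg' : HasCompactSupport g) (e : Eucl n) {t : ℝ} (ht : 0 < t) :
    diffPairing f g e (t / 2) - diffPairing f g e t =
      -t⁻¹ * ∫ x, (f (x + -((t / 2) • e)) - f x) * (g (x + (t / 2) • e) - g x) := by
  set a := (t / 2) • e with ha
  have h2 : t • e = a + a := by rw [ha, ← add_smul]; norm_num
  have i0 : Integrable fun x => g x * f x := by
    simpa using integrable_comp_add_mul hf hg hg' 0
  have i1 := integrable_comp_add_mul hf hg hg' a
  have i2 : Integrable fun x => g (x + a + a) * f x := by
    simpa [add_assoc] using integrable_comp_add_mul hf hg hg' (a + a)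
  have e1 : diffPairing f g e (t / 2) =
      t⁻¹ * (2 * ∫ x, g (x + a) * f x) - t⁻¹ * (2 * ∫ x, g x * f x) := by
    unfold diffPairing
    rw [← mul_sub, ← mul_sub, ← integral_sub i1 i0, ← integral_const_mul, ← integral_const_mul]
    congr 1; ext x
    simp only [smul_eq_mul, inv_div]
    field_simp
    ring
  have e2 : diffPairing f g e t = t⁻¹ * (∫ x, g (x + a + a) * f x) - t⁻¹ * ∫ x, g x * f x := by
    unfold diffPairing
    rw [← mul_sub, ← integral_sub i2 i0, ← integral_const_mul, h2]
    congr 1; ext x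
    simp only [smul_eq_mul, add_assoc]
    ring
  have j1 : Integrable fun x => f (x + -a) * (g (x + a) - g x) := by
    have := (i2.sub i1).comp_add_right (-a)
    refine this.congr (.of_forall fun x => ?_)
    simp; ring
  have j2 : Integrable fun x => f x * (g (x + a) - g x) := by
    refine (i1.sub i0).congr (.of_forall fun x => ?_)
    simp; ring
  have e3 : ∫ x, (f (x + -a) - f x) * (g (x + a) - g x) =
      (∫ x, f (x + -a) * (g (x + a) - g x)) - ∫ x, f x * (g (x + a) - g x) := by
    rw [← integral_sub j1 j2]
    congr 1; ext x; ring
  have e4 : ∫ x, f (x + -a) * (g (x + a) - g x) =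
      (∫ x, g (x + a + a) * f x) - ∫ x, g (x + a) * f x := by
    rw [← integral_sub i2 i1, ← integral_add_right_eq_self (fun x => f (x + -a) * _) a]
    congr 1; ext x; simp; ring
  have e5 : ∫ x, f x * (g (x + a) - g x) = (∫ x, g (x + a) * f x) - ∫ x, g x * f x := by
    rw [← integral_sub i1 i0]
    congr 1; ext x; ring
  rw [e1, e2, e3, e4, e5]
  ring

theorem enorm_diffPairing_half_sub_le {p q : ℝ} (hpq : p.HolderConjugate q) {f g : Eucl n → ℝ}
    (hfm : Measurable f) (hf : Integrable f) (hg : Continuous g) (hg' : HasCompactSupport g)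
    (e : Eucl n) {t : ℝ} (ht : 0 < t) :
    ‖diffPairing f g e (t / 2) - diffPairing f g e t‖ₑ ≤ ENNReal.ofReal t⁻¹ *
      (translModulus p f ((t / 2) • e) ^ (1 / p) * translModulus q g ((t / 2) • e) ^ (1 / q)) := by
  rw [diffPairing_half_sub hf hg hg' e ht, enorm_mul, enorm_neg,
    Real.enorm_of_nonneg (by positivity)]
  gcongr
  rw [← translModulus_neg f]
  exact enorm_integral_mul_le hpq (by fun_prop) (by fun_prop)

/-- The starting value of the telescoping sum: at scale `1` no smoothness is needed. The `4` comes
from `2^q · 2 ≤ 4^q`. -/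
theorem enorm_diffPairing_one_le {p q : ℝ} (hpq : p.HolderConjugate q) {f g : Eucl n → ℝ}
    (hfm : Measurable f) (hg : Continuous g) (e : Eucl n) :
    ‖diffPairing f g e 1‖ₑ ≤ 4 * ((∫⁻ x, ‖f x‖ₑ ^ p) ^ (1 / p) *
      (∫⁻ x, ‖g x‖ₑ ^ q) ^ (1 / q)) := by
  have hq : 0 < q := hpq.symm.pos
  have h1 : (translModulus q g e) ^ (1 / q) ≤ 4 * (∫⁻ x, ‖g x‖ₑ ^ q) ^ (1 / q) := by
    calc _ ≤ (2 ^ q * (2 * ∫⁻ x, ‖g x‖ₑ ^ q)) ^ (1 / q) := by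
          gcongr
          exact translModulus_le_norm hpq.symm.lt.le hg.measurable e
      _ ≤ (4 ^ q * ∫⁻ x, ‖g x‖ₑ ^ q) ^ (1 / q) := by
          rw [← mul_assoc]
          gcongr
          have h4 : (4 : ℝ≥0∞) = 2 * 2 := by norm_num
          rw [h4, ENNReal.mul_rpow_of_nonneg _ _ hq.le]
          gcongr
          exact ENNReal.le_rpow_self_of_one_le (by norm_num) hpq.symm.lt.le
      _ = _ := by
          rw [ENNReal.mul_rpow_of_nonneg _ _ (by positivity), ← ENNReal.rpow_mul,
            mul_one_div_cancel hq.ne', ENNReal.rpow_one]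
  have h2 : diffPairing f g e 1 = ∫ x, f x * (g (x + e) - g x) := by
    unfold diffPairing
    congr 1; ext x; simp; ring
  rw [h2]
  refine (enorm_integral_mul_le hpq hfm (by fun_prop)).trans ?_
  change _ * (translModulus q g e) ^ (1 / q) ≤ _
  calc _ ≤ (∫⁻ x, ‖f x‖ₑ ^ p) ^ (1 / p) * (4 * (∫⁻ x, ‖g x‖ₑ ^ q) ^ (1 / q)) := by gcongr
    _ = _ := by ring

theorem enorm_diffPairing_pow_le {p q : ℝ} (hpq : p.HolderConjugate q) {f g : Eucl n → ℝ}
    (hfm : Measurable f) (hf : Integrable f) (hg : Continuous g) (hg' : HasCompactSupport g)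
    (e : Eucl n) (N : ℕ) :
    ‖diffPairing f g e ((1 / 2) ^ N)‖ₑ ≤ ‖diffPairing f g e 1‖ₑ +
      ∑ j ∈ Finset.range N, ENNReal.ofReal ((1 / 2 : ℝ) ^ j)⁻¹ *
        (translModulus p f ((1 / 2 : ℝ) ^ (j + 1) • e) ^ (1 / p) *
          translModulus q g ((1 / 2 : ℝ) ^ (j + 1) • e) ^ (1 / q)) := by
  induction N with
  | zero => simp
  | succ N ih =>
    rw [Finset.sum_range_succ, ← add_assoc]
    have h := enorm_diffPairing_half_sub_le hpq hfm hf hg hg' e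
      (t := (1 / 2 : ℝ) ^ N) (by positivity)
    have h2 : (1 / 2 : ℝ) ^ N / 2 = (1 / 2) ^ (N + 1) := by rw [pow_succ]; ring
    rw [h2] at h
    refine le_trans ?_ (add_le_add ih h)
    simpa using enorm_add_le (diffPairing f g e ((1 / 2) ^ N))
      (diffPairing f g e ((1 / 2) ^ (N + 1)) - diffPairing f g e ((1 / 2) ^ N))

/-- The factor `2^j` is at most `τ^{-s} τ^{-(1-s)}` with `τ = 2^{-(j+1)}`. One factor goes to `f`
and the other to `g`, and Hölder's inequality for sums separates them. The orders must add up to `1`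
exactly for this. -/
theorem exists_sum_dyadic_le {p q s : ℝ} (hpq : p.HolderConjugate q) (hs0 : 0 < s) (hs1 : s < 1) :
    ∃ C : ℝ≥0, ∀ f g : Eucl n → ℝ, Measurable f → Measurable g → ∀ e : Eucl n, ‖e‖ = 1 →
      ∀ N : ℕ, ∑ j ∈ Finset.range N, ENNReal.ofReal ((1 / 2 : ℝ) ^ j)⁻¹ *
        (translModulus p f ((1 / 2 : ℝ) ^ (j + 1) • e) ^ (1 / p) *
          translModulus q g ((1 / 2 : ℝ) ^ (j + 1) • e) ^ (1 / q)) ≤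
        C * (gagliardo p s f ^ (1 / p) * gagliardo q (1 - s) g ^ (1 / q)) := by
  have hp := hpq.lt
  have hq := hpq.symm.lt
  obtain ⟨A, hA⟩ := exists_sum_translModulus_le (n := n) hp.le hs0
  obtain ⟨B, hB⟩ := exists_sum_translModulus_le (n := n) hq.le (sub_pos.2 hs1)
  have hCt : (A : ℝ≥0∞) ^ (1 / p) * (B : ℝ≥0∞) ^ (1 / q) ≠ ∞ := by
    refine ENNReal.mul_ne_top ?_ ?_ <;>
      exact ENNReal.rpow_ne_top_of_nonneg (by positivity) (by simp)
  refine ⟨((A : ℝ≥0∞) ^ (1 / p) * (B : ℝ≥0∞) ^ (1 / q)).toNNReal, fun f g hf hg e he N => ?_⟩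
  rw [ENNReal.coe_toNNReal hCt]
  -- The translation length is half the scale `2^{-j}` of the prefactor; only `2^j ≤ (τ j)⁻¹` is
  -- used.
  set τ : ℕ → ℝ := fun j => (1 / 2 : ℝ) ^ (j + 1) with hτ
  have hτ0 : ∀ j, 0 < τ j := fun j => by positivity
  set a : ℕ → ℝ≥0∞ := fun j =>
    (ENNReal.ofReal (τ j ^ (-(s * p))) * translModulus p f (τ j • e)) ^ (1 / p)
  set b : ℕ → ℝ≥0∞ := fun j =>
    (ENNReal.ofReal (τ j ^ (-((1 - s) * q))) * translModulus q g (τ j • e)) ^ (1 / q)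
  have hterm : ∀ j, ENNReal.ofReal ((1 / 2 : ℝ) ^ j)⁻¹ *
        (translModulus p f (τ j • e) ^ (1 / p) * translModulus q g (τ j • e) ^ (1 / q)) ≤
        a j * b j := by
    intro j
    have e1 : ∀ r θ : ℝ, 0 < r → (ENNReal.ofReal (τ j ^ (-(θ * r)))) ^ (1 / r) =
        ENNReal.ofReal (τ j ^ (-θ)) := by
      intro r θ hr
      rw [ENNReal.ofReal_rpow_of_pos (Real.rpow_pos_of_pos (hτ0 j) _),
        ← Real.rpow_mul (hτ0 j).le]
      congr 2
      field_simp
    have e2 : ENNReal.ofReal ((1 / 2 : ℝ) ^ j)⁻¹ ≤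
        ENNReal.ofReal (τ j ^ (-s)) * ENNReal.ofReal (τ j ^ (-(1 - s))) := by
      rw [← ENNReal.ofReal_mul (Real.rpow_nonneg (hτ0 j).le _), ← Real.rpow_add (hτ0 j)]
      refine ENNReal.ofReal_le_ofReal ?_
      have : -s + -(1 - s) = -1 := by ring
      rw [this, Real.rpow_neg_one]
      refine inv_anti₀ (hτ0 j) ?_
      exact pow_le_pow_of_le_one (by norm_num) (by norm_num) (Nat.le_succ j)
    simp only [a, b]
    rw [ENNReal.mul_rpow_of_nonneg _ _ (by positivity),
      ENNReal.mul_rpow_of_nonneg _ _ (by positivity), e1 p s (by linarith),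
      e1 q (1 - s) (by linarith)]
    calc _ ≤ _ := mul_le_mul_left e2 _
      _ = _ := by ring
  have hpowa : ∀ j, a j ^ p =
      ENNReal.ofReal (τ j ^ (-(s * p))) * translModulus p f (τ j • e) := fun j => by
    simp only [a]
    rw [← ENNReal.rpow_mul, one_div_mul_cancel (by linarith), ENNReal.rpow_one]
  have hpowb : ∀ j, b j ^ q =
      ENNReal.ofReal (τ j ^ (-((1 - s) * q))) * translModulus q g (τ j • e) := fun j => by
    simp only [b]
    rw [← ENNReal.rpow_mul, one_div_mul_cancel (by linarith), ENNReal.rpow_one]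
  -- The scales that occur are `2^{-1}, …, 2^{-N}`, so the sum over an arbitrary finite set of
  -- exponents is applied to the shifted range.
  have hshift : ∀ F : ℕ → ℝ≥0∞, ∑ j ∈ Finset.range N, F (j + 1) =
      ∑ j ∈ (Finset.range N).map (addRightEmbedding 1), F j := fun F => by simp
  calc _ ≤ ∑ j ∈ Finset.range N, a j * b j := Finset.sum_le_sum fun j _ => hterm j
    _ ≤ (∑ j ∈ Finset.range N, a j ^ p) ^ (1 / p) * (∑ j ∈ Finset.range N, b j ^ q) ^ (1 / q) :=
        ENNReal.inner_le_Lp_mul_Lq _ _ _ hpq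
    _ ≤ (A * gagliardo p s f) ^ (1 / p) * (B * gagliardo q (1 - s) g) ^ (1 / q) := by
        simp only [hpowa, hpowb, hτ]
        gcongr
        · rw [hshift fun j => ENNReal.ofReal (((1 / 2 : ℝ) ^ j) ^ (-(s * p))) *
            translModulus p f ((1 / 2 : ℝ) ^ j • e)]
          exact hA f hf e he _
        · rw [hshift fun j => ENNReal.ofReal (((1 / 2 : ℝ) ^ j) ^ (-((1 - s) * q))) *
            translModulus q g ((1 / 2 : ℝ) ^ j • e)]
          exact hB g hg e he _
    _ = _ := by
        rw [ENNReal.mul_rpow_of_nonneg _ _ (by positivity),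
          ENNReal.mul_rpow_of_nonneg _ _ (by positivity)]
        ring

/-- Along `t = 2^{-N}` the difference-quotient pairings converge to the left side, and telescoping
from scale `1` bounds them uniformly in `N`. The derivative stays on `g`, so `f` need only be
integrable. -/
theorem exists_integral_lineDeriv_le {p q s : ℝ} (hpq : p.HolderConjugate q) (hs0 : 0 < s)
    (hs1 : s < 1) :
    ∃ C : ℝ≥0, ∀ f g : Eucl n → ℝ, Measurable f → Integrable f → ContDiff ℝ 1 g →
      HasCompactSupport g → ∀ e : Eucl n, ‖e‖ = 1 →
      ‖∫ x, lineDeriv ℝ g x e * f x‖ₑ ≤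
        C * ((∫⁻ x, ‖f x‖ₑ ^ p) ^ (1 / p) * (∫⁻ x, ‖g x‖ₑ ^ q) ^ (1 / q) +
          gagliardo p s f ^ (1 / p) * gagliardo q (1 - s) g ^ (1 / q)) := by
  obtain ⟨C, hC⟩ := exists_sum_dyadic_le (n := n) hpq hs0 hs1
  refine ⟨4 + C, fun f g hfm hf hg hg' e he => ?_⟩
  obtain ⟨K, hK⟩ := hg.lipschitzWith_of_hasCompactSupport hg' one_ne_zero
  have hlim := hK.integral_inv_smul_sub_mul_tendsto_integral_lineDeriv_mul hf e
  have hpow : Filter.Tendsto (fun N : ℕ => (1 / 2 : ℝ) ^ N) Filter.atTop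
      (nhdsWithin 0 (Set.Ioi 0)) :=
    tendsto_nhdsWithin_iff.2 ⟨tendsto_pow_atTop_nhds_zero_of_lt_one (by norm_num) (by norm_num),
      .of_forall fun N => by simp⟩
  refine le_of_tendsto (hlim.comp hpow).enorm (.of_forall fun N => ?_)
  refine (enorm_diffPairing_pow_le hpq hfm hf hg.continuous hg' e N).trans ?_
  refine (add_le_add (enorm_diffPairing_one_le hpq hfm hg.continuous e)
    (hC f g hfm hg.continuous.measurable e he N)).trans ?_
  rw [mul_add]
  gcongr
  · rw [ENNReal.coe_add]; exact le_self_add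
  · exact le_add_self

/-! ### Functions with a Lipschitz factor -/

/-- The kernel `min(1, |w|^p) |w|^{-(n + θp)}`. -/
def truncKernel (p θ : ℝ) (w : Eucl n) : ℝ≥0∞ :=
  ENNReal.ofReal (min 1 (‖w‖ ^ p)) * gagliardoKernel p θ w

theorem measurable_truncKernel (p θ : ℝ) : Measurable (truncKernel p θ : Eucl n → ℝ≥0∞) := by
  have := measurable_gagliardoKernel (n := n) p θ
  unfold truncKernel
  fun_prop

theorem truncKernel_neg (p θ : ℝ) (w : Eucl n) : truncKernel p θ (-w) = truncKernel p θ w := by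
  simp [truncKernel, gagliardoKernel_neg]

/-- In polar coordinates the integrand is `r^{p(1-θ)-1}` for `r ≤ 1`, integrable since `θ < 1`, and
`r^{-1-θp}` for `r > 1`, integrable since `θ > 0`. -/
theorem lintegral_truncKernel_lt_top (hn : 0 < n) {p θ : ℝ} (hp : 0 < p) (hθ0 : 0 < θ)
    (hθ1 : θ < 1) : ∫⁻ w : Eucl n, truncKernel p θ w < ∞ := by
  have : Nontrivial (Eucl n) := by
    have : Nonempty (Fin n) := ⟨⟨0, hn⟩⟩
    infer_instance
  set F : ℝ → ℝ := fun r => min 1 (r ^ p) * r ^ (-((n : ℝ) + θ * p)) with hF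
  have hint : Integrable fun w : Eucl n => F ‖w‖ := by
    rw [integrable_fun_norm_addHaar, finrank_euclideanSpace_fin]
    have hcast : ((n - 1 : ℕ) : ℝ) = n - 1 := by
      rw [Nat.cast_sub hn, Nat.cast_one]
    have hmul : ∀ y : ℝ, 0 < y → ∀ a : ℝ, y ^ (n - 1) * y ^ a = y ^ ((n : ℝ) - 1 + a) := by
      intro y hy a
      rw [← Real.rpow_natCast, hcast, Real.rpow_add hy]
    rw [← Ioc_union_Ioi_eq_Ioi (zero_le_one' ℝ)]
    refine IntegrableOn.union ?_ ?_
    · have h1 : IntegrableOn (fun y : ℝ => y ^ (p * (1 - θ) - 1)) (Ioc 0 1) := by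
        rw [← intervalIntegrable_iff_integrableOn_Ioc_of_le zero_le_one]
        refine intervalIntegral.intervalIntegrable_rpow' ?_
        have : 0 < p * (1 - θ) := mul_pos hp (by linarith)
        linarith
      refine h1.congr_fun (fun y hy => ?_) measurableSet_Ioc
      have hy0 : 0 < y := hy.1
      have hm : min 1 (y ^ p) = y ^ p := min_eq_right (Real.rpow_le_one hy0.le hy.2 hp.le)
      simp only [hF, hm, smul_eq_mul]
      rw [← Real.rpow_add hy0, hmul y hy0]
      congr 1; ring
    · have h1 : IntegrableOn (fun y : ℝ => y ^ (-1 - θ * p)) (Ioi 1) := by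
        refine integrableOn_Ioi_rpow_of_lt ?_ one_pos
        have : 0 < θ * p := by positivity
        linarith
      refine h1.congr_fun (fun y hy => ?_) measurableSet_Ioi
      have hy1 : 1 < y := hy
      have hm : min 1 (y ^ p) = 1 := min_eq_left (Real.one_le_rpow hy1.le hp.le)
      simp only [hF, hm, smul_eq_mul, one_mul]
      rw [hmul y (by linarith)]
      congr 1; ring
  refine lt_of_eq_of_lt ?_ hint.lintegral_lt_top
  refine lintegral_congr fun w => ?_
  rw [truncKernel, gagliardoKernel, ← ENNReal.ofReal_mul (by positivity)]

/-- The Lipschitz bound serves for near points and the sup bound for far ones. -/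
theorem exists_enorm_sub_rpow_le_min {p : ℝ} (hp : 0 < p) {φ : Eucl n → ℝ} (hφ : ContDiff ℝ 1 φ)
    (hφ' : HasCompactSupport φ) :
    ∃ C : ℝ≥0, ∀ x y, ‖φ x - φ y‖ₑ ^ p ≤ C * ENNReal.ofReal (min 1 (‖x - y‖ ^ p)) := by
  obtain ⟨K, hK⟩ := hφ.lipschitzWith_of_hasCompactSupport hφ' one_ne_zero
  obtain ⟨M, hM⟩ := hφ.continuous.bounded_above_of_compact_support hφ'
  have hM0 : 0 ≤ M := (norm_nonneg _).trans (hM 0)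
  set L : ℝ := max K (2 * M)
  have hL0 : 0 ≤ L := le_max_of_le_left K.2
  refine ⟨(L ^ p).toNNReal, fun x y => ?_⟩
  have h1 : ‖φ x - φ y‖ ≤ L * ‖x - y‖ :=
    (hK.norm_sub_le x y).trans (by gcongr; exact le_max_left _ _)
  have h2 : ‖φ x - φ y‖ ≤ L := by
    refine (norm_sub_le _ _).trans (le_trans ?_ (le_max_right _ _))
    linarith [hM x, hM y]
  have h3 : ‖φ x - φ y‖ ^ p ≤ L ^ p * min 1 (‖x - y‖ ^ p) := by
    rw [mul_min_of_nonneg _ _ (by positivity), mul_one]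
    refine le_min (Real.rpow_le_rpow (norm_nonneg _) h2 hp.le) ?_
    rw [← Real.mul_rpow hL0 (norm_nonneg _)]
    exact Real.rpow_le_rpow (norm_nonneg _) h1 hp.le
  rw [← ofReal_norm, ENNReal.ofReal_rpow_of_nonneg (norm_nonneg _) hp.le]
  refine (ENNReal.ofReal_le_ofReal h3).trans ?_
  rw [ENNReal.ofReal_mul (by positivity)]
  rfl

theorem lintegral_prod_mul_truncKernel {p θ : ℝ} {F : Eucl n → ℝ≥0∞} (hF : Measurable F) :
    ∫⁻ z : Eucl n × Eucl n, F z.1 * truncKernel p θ (z.1 - z.2) ∂(volume.prod volume) =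
      (∫⁻ x, F x) * ∫⁻ w : Eucl n, truncKernel p θ w := by
  have hk := measurable_truncKernel (n := n) p θ
  rw [lintegral_prod _ (by fun_prop), ← lintegral_mul_const _ hF]
  refine lintegral_congr fun x => ?_
  dsimp only
  rw [lintegral_const_mul _ (by fun_prop), lintegral_sub_left_eq_self (truncKernel p θ) x]

theorem lintegral_prod_mul_truncKernel' {p θ : ℝ} {F : Eucl n → ℝ≥0∞} (hF : Measurable F) :
    ∫⁻ z : Eucl n × Eucl n, F z.2 * truncKernel p θ (z.1 - z.2) ∂(volume.prod volume) =
      (∫⁻ x, F x) * ∫⁻ w : Eucl n, truncKernel p θ w := by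
  rw [← lintegral_prod_mul_truncKernel hF, ← lintegral_prod_swap]
  refine lintegral_congr fun z => ?_
  simp only [Prod.snd_swap, Prod.fst_swap]
  rw [← truncKernel_neg, neg_sub]

/-- The `p`-th power of the Slobodeckij seminorm on `Ω`. -/
def gagliardoOn (p θ : ℝ) (Ω : Set (Eucl n)) (f : Eucl n → ℝ) : ℝ≥0∞ :=
  ∫⁻ z : Eucl n × Eucl n, ‖f z.1 - f z.2‖ₑ ^ p * gagliardoKernel p θ (z.1 - z.2)
    ∂((volume.restrict Ω).prod (volume.restrict Ω))

theorem gagliardoOn_le {p θ : ℝ} {f : Eucl n → ℝ} (hf : Measurable f) (Ω : Set (Eucl n)) :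
    gagliardoOn p θ Ω f ≤ gagliardo p θ f := by
  rw [← lintegral_gagliardo hf, gagliardoOn, Measure.prod_restrict]
  exact setLIntegral_le_lintegral _ _

/-- For `x, y ∈ Ω` write the difference as `φ(x)(f(x) - f(y)) + f(y)(φ(x) - φ(y))`. If only `x ∈ Ω`,
then `φ(y) = 0` and the difference is `f(x)(φ(x) - φ(y))`, so values of `f` outside `Ω` never enter.
-/
theorem enorm_mul_sub_mul_rpow_le {p : ℝ} (hp : 1 < p) {Ω : Set (Eucl n)} {φ f : Eucl n → ℝ}
    {M : ℝ≥0} (hM : ∀ x, ‖φ x‖ₑ ≤ M) (hsupp : ∀ x ∉ Ω, φ x = 0) (x y : Eucl n) :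
    ‖φ x * f x - φ y * f y‖ₑ ^ p ≤
      2 ^ p * (M ^ p * ((Ω ×ˢ Ω).indicator (fun z => ‖f z.1 - f z.2‖ₑ ^ p) (x, y)) +
        (Ω.indicator (fun x => ‖f x‖ₑ ^ p) x + Ω.indicator (fun x => ‖f x‖ₑ ^ p) y) *
          ‖φ x - φ y‖ₑ ^ p) := by
  have hp0 : 0 < p := by linarith
  have h2 : (1 : ℝ≥0∞) ≤ 2 ^ p := ENNReal.one_le_rpow (by norm_num) hp0
  by_cases hx : x ∈ Ω <;> by_cases hy : y ∈ Ω
  · have e : φ x * f x - φ y * f y = φ x * (f x - f y) + f y * (φ x - φ y) := by ring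
    rw [e]
    refine (enorm_add_rpow_le hp.le _ _).trans ?_
    simp only [hx, hy, indicator_of_mem, mem_prod, and_self, enorm_mul,
      ENNReal.mul_rpow_of_nonneg _ _ hp0.le]
    gcongr
    · exact hM x
    · exact le_add_self
  · refine le_trans ?_ (le_mul_of_one_le_left' h2)
    simp [hx, hy, hsupp y hy, ENNReal.mul_rpow_of_nonneg _ _ hp0.le, mul_comm]
  · refine le_trans ?_ (le_mul_of_one_le_left' h2)
    simp [hx, hy, hsupp x hx, ENNReal.mul_rpow_of_nonneg _ _ hp0.le, mul_comm]
  · simp [hsupp x hx, hsupp y hy, hp0]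

/-- Extension by zero across the boundary of `Ω` is harmless after cut-off: differences of `f` give
the seminorm on `Ω`, while differences of `φ` turn the kernel into the integrable `truncKernel` and
leave the `L^p` norm. -/
theorem exists_gagliardo_mul_le (hn : 0 < n) {p θ : ℝ} (hp : 1 < p) (hθ0 : 0 < θ) (hθ1 : θ < 1)
    {Ω : Set (Eucl n)} (hΩ : MeasurableSet Ω) {φ : Eucl n → ℝ} (hφ : ContDiff ℝ 1 φ)
    (hφ' : HasCompactSupport φ) (hsupp : ∀ x ∉ Ω, φ x = 0) :
    ∃ C : ℝ≥0, ∀ f : Eucl n → ℝ, Measurable f →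
      gagliardo p θ (fun x => φ x * f x) ≤
        C * ((∫⁻ x in Ω, ‖f x‖ₑ ^ p) + gagliardoOn p θ Ω f) := by
  have hp0 : 0 < p := by linarith
  obtain ⟨D, hD⟩ := exists_enorm_sub_rpow_le_min hp0 hφ hφ'
  obtain ⟨M', hM'⟩ := hφ.continuous.bounded_above_of_compact_support hφ'
  set M : ℝ≥0 := M'.toNNReal
  have hM : ∀ x, ‖φ x‖ₑ ≤ M := fun x => by
    rw [← ofReal_norm]; exact ENNReal.ofReal_le_ofReal (hM' x)
  set I := ∫⁻ w : Eucl n, truncKernel p θ w with hI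
  have hIt : I ≠ ∞ := (lintegral_truncKernel_lt_top hn hp0 hθ0 hθ1).ne
  set C : ℝ≥0∞ := 2 ^ p * (M ^ p + D * (2 * I)) with hC
  have h2t : (2 : ℝ≥0∞) ^ p ≠ ∞ := ENNReal.rpow_ne_top_of_nonneg hp0.le (by simp)
  have hMt : (M : ℝ≥0∞) ^ p ≠ ∞ := ENNReal.rpow_ne_top_of_nonneg hp0.le (by simp)
  have hCt : C ≠ ∞ := ENNReal.mul_ne_top h2t (ENNReal.add_ne_top.2 ⟨hMt,
    ENNReal.mul_ne_top (by simp) (ENNReal.mul_ne_top (by simp) hIt)⟩)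
  refine ⟨C.toNNReal, fun f hf => ?_⟩
  rw [ENNReal.coe_toNNReal hCt]
  have hk := measurable_gagliardoKernel (n := n) p θ
  have hkt := measurable_truncKernel (n := n) p θ
  have hφm := hφ.continuous.measurable
  set N : Eucl n → ℝ≥0∞ := Ω.indicator fun x => ‖f x‖ₑ ^ p
  have hN : Measurable N := Measurable.indicator (by fun_prop) hΩ
  have hNi : ∫⁻ x, N x = ∫⁻ x in Ω, ‖f x‖ₑ ^ p := lintegral_indicator hΩ _
  set G : Eucl n × Eucl n → ℝ≥0∞ := fun z =>
    (Ω ×ˢ Ω).indicator (fun z => ‖f z.1 - f z.2‖ₑ ^ p) z * gagliardoKernel p θ (z.1 - z.2)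
  have hG : Measurable G :=
    (Measurable.indicator (by fun_prop) (hΩ.prod hΩ)).mul (by fun_prop)
  have hGi : ∫⁻ z, G z ∂(volume.prod volume) = gagliardoOn p θ Ω f := by
    rw [gagliardoOn, Measure.prod_restrict, ← lintegral_indicator (hΩ.prod hΩ)]
    refine lintegral_congr fun z => ?_
    by_cases hz : z ∈ Ω ×ˢ Ω
    · simp only [G, indicator_of_mem hz]
    · simp only [G, indicator_of_notMem hz, zero_mul]
  rw [← lintegral_gagliardo (by fun_prop)]
  calc _ ≤ ∫⁻ z : Eucl n × Eucl n, 2 ^ p * (M ^ p * G z +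
          D * (N z.1 * truncKernel p θ (z.1 - z.2) + N z.2 * truncKernel p θ (z.1 - z.2)))
          ∂(volume.prod volume) := by
        refine lintegral_mono fun z => ?_
        refine (mul_le_mul_left (enorm_mul_sub_mul_rpow_le hp hM hsupp z.1 z.2) _).trans ?_
        rw [mul_assoc]
        gcongr
        rw [add_mul]
        refine add_le_add (le_of_eq (mul_assoc _ _ _)) ?_
        calc _ ≤ (N z.1 + N z.2) * (D * ENNReal.ofReal (min 1 (‖z.1 - z.2‖ ^ p))) *
              gagliardoKernel p θ (z.1 - z.2) := by
                gcongr
                exact hD z.1 z.2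
          _ = _ := by rw [truncKernel]; ring
    _ = 2 ^ p * (M ^ p * gagliardoOn p θ Ω f + D * (2 * I * ∫⁻ x in Ω, ‖f x‖ₑ ^ p)) := by
        rw [lintegral_const_mul _ (by fun_prop), lintegral_add_left (by fun_prop),
          lintegral_const_mul _ hG, hGi, lintegral_const_mul _ (by fun_prop),
          lintegral_add_left (by fun_prop), lintegral_prod_mul_truncKernel hN,
          lintegral_prod_mul_truncKernel' hN, hNi]
        ring
    -- The cross terms are added so that the bound factors as one constant times a sum.
    _ ≤ 2 ^ p * (M ^ p * gagliardoOn p θ Ω f + D * (2 * I * ∫⁻ x in Ω, ‖f x‖ₑ ^ p)) +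
          2 ^ p * (M ^ p * (∫⁻ x in Ω, ‖f x‖ₑ ^ p) + D * (2 * I) * gagliardoOn p θ Ω f) :=
        le_self_add
    _ = _ := by rw [hC]; ring

/-! ### Functions with an integrable weak derivative -/

/-- `g` is the weak derivative of `h` on `ℝⁿ` in the direction `z`. -/
def HasWeakLineDeriv (h g : Eucl n → ℝ) (z : Eucl n) : Prop :=
  ∀ ψ : Eucl n → ℝ, ContDiff ℝ (⊤ : ℕ∞) ψ → HasCompactSupport ψ →
    ∫ x, lineDeriv ℝ ψ x z * h x = -∫ x, ψ x * g x

theorem integrable_prod_comp_add_smul {g : Eucl n → ℝ} (hgm : Measurable g) (hg : Integrable g)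
    (z : Eucl n) : Integrable (fun q : Eucl n × ℝ => g (q.1 + q.2 • z))
      (volume.prod (volume.restrict (Ioc 0 1))) := by
  have hm : Measurable fun q : Eucl n × ℝ => g (q.1 + q.2 • z) := by fun_prop
  rw [integrable_prod_iff' hm.aestronglyMeasurable]
  refine ⟨.of_forall fun t => hg.comp_add_right (t • z), ?_⟩
  simp only [integral_add_right_eq_self (fun x => ‖g x‖)]
  exact integrable_const _

/-- The fundamental theorem of calculus in weak form, applied on `[0, 1]` to `t ↦ ∫ ψ(x - t z) h(x)
dx`: its derivative acts on the smooth `ψ`, so `h` need not be differentiable. -/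
theorem HasWeakLineDeriv.integral_sub_eq {h g : Eucl n → ℝ} {z : Eucl n}
    (hw : HasWeakLineDeriv h g z) (hhm : Measurable h) (hh : Integrable h) (hgm : Measurable g)
    (hg : Integrable g) {ψ : Eucl n → ℝ} (hψs : ContDiff ℝ (⊤ : ℕ∞) ψ)
    (hψ' : HasCompactSupport ψ) :
    ∫ x, ψ x * (h (x + z) - h x) = ∫ x, ψ x * ∫ t in Ioc (0 : ℝ) 1, g (x + t • z) := by
  have hψ : ContDiff ℝ 1 ψ := hψs.of_le (by exact_mod_cast le_top)
  obtain ⟨M, hM⟩ := hψ.continuous.bounded_above_of_compact_support hψ'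
  obtain ⟨K, hK⟩ := hψ.lipschitzWith_of_hasCompactSupport hψ' one_ne_zero
  have hψm := hψ.continuous.measurable
  have hder : ∀ t : ℝ, HasDerivAt (fun t : ℝ => ∫ x, ψ (x - t • z) * h x)
      (∫ x, ψ x * g (x + t • z)) t := by
    intro t
    have hd : ∀ (x : Eucl n) (t : ℝ), HasDerivAt (fun t : ℝ => ψ (x - t • z))
        (-lineDeriv ℝ (fun y => ψ (y - t • z)) x z) t := by
      intro x t
      have hdiff : DifferentiableAt ℝ ψ (x - t • z) := hψ.differentiable one_ne_zero _
      have h1 : HasDerivAt (fun t : ℝ => x - t • z) (-z) t := by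
        simpa using ((hasDerivAt_id t).smul_const z).const_sub x
      have h2 := hdiff.hasFDerivAt.comp_hasDerivAt t h1
      have h3 : lineDeriv ℝ (fun y => ψ (y - t • z)) x z = fderiv ℝ ψ (x - t • z) z := by
        have : DifferentiableAt ℝ (fun y => ψ (y - t • z)) x := by fun_prop
        rw [this.lineDeriv_eq_fderiv, fderiv_comp_sub]
      rw [h3]
      exact h2.congr_deriv (map_neg _ _)
    have hmain := hasDerivAt_integral_of_dominated_loc_of_deriv_le (μ := volume)
      (F := fun t x => ψ (x - t • z) * h x)
      (F' := fun t x => -lineDeriv ℝ (fun y => ψ (y - t • z)) x z * h x)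
      (bound := fun x => K * ‖z‖ * ‖h x‖) (x₀ := t) (s := univ) Filter.univ_mem
      (.of_forall fun t => by fun_prop)
      (hh.bdd_mul (c := M) (by fun_prop) (.of_forall fun x => hM _))
      (by
        have hc : Continuous fun y => ψ (y - t • z) := by fun_prop
        exact ((measurable_lineDeriv hc).neg.mul hhm).aestronglyMeasurable)
      (.of_forall fun x t _ => by
        rw [norm_mul, norm_neg]
        gcongr
        have : LipschitzWith K fun y => ψ (y - t • z) := by
          simpa [Function.comp_def] using hK.comp (LipschitzWith.id.sub (LipschitzWith.const (t • z)))
        exact norm_lineDeriv_le_of_lipschitz ℝ this)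
      (hh.norm.const_mul _)
      (.of_forall fun x t _ => (hd x t).mul_const (h x))
    refine hmain.2.congr_deriv ?_
    -- The translate of `ψ` is again an admissible test function; translating back by `t z` puts the
    -- shift on `g`.
    have hwt := hw (fun y => ψ (y - t • z)) (by fun_prop)
      (hψ'.comp_homeomorph (Homeomorph.subRight (t • z)))
    simp only [neg_mul, integral_neg, hwt, neg_neg]
    rw [← integral_add_right_eq_self _ (t • z)]
    simp
  have hprod : Integrable (fun q : Eucl n × ℝ => ψ q.1 * g (q.1 + q.2 • z))
      (volume.prod (volume.restrict (Ioc 0 1))) :=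
    (integrable_prod_comp_add_smul hgm hg z).bdd_mul (c := M) (by fun_prop)
      (.of_forall fun q => hM q.1)
  have hint : IntervalIntegrable (fun t => ∫ x, ψ x * g (x + t • z)) volume 0 1 := by
    rw [intervalIntegrable_iff_integrableOn_Ioc_of_le zero_le_one]
    exact hprod.integral_prod_right
  have hftc := intervalIntegral.integral_eq_sub_of_hasDerivAt (fun t _ => hder t) hint
  rw [intervalIntegral.integral_of_le zero_le_one,
    integral_integral_swap (f := fun t x => ψ x * g (x + t • z)) hprod.swap] at hftc
  simp only [integral_const_mul] at hftc
  rw [hftc]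
  have i1 : Integrable fun x => ψ x * h (x + z) :=
    (hh.comp_add_right z).bdd_mul (c := M) (by fun_prop) (.of_forall hM)
  have i2 : Integrable fun x => ψ x * h x :=
    hh.bdd_mul (c := M) (by fun_prop) (.of_forall hM)
  simp only [mul_sub]
  rw [integral_sub i1 i2, ← integral_add_right_eq_self (fun x => ψ (x - (1 : ℝ) • z) * h x) z]
  simp

/-- Almost everywhere `h(x + z) - h(x)` is the mean of `g` over the segment from `x` to `x + z`.
Jensen's inequality and translation invariance finish. -/
theorem HasWeakLineDeriv.translModulus_le {p : ℝ} (hp : 1 ≤ p) {h g : Eucl n → ℝ} {z : Eucl n}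
    (hw : HasWeakLineDeriv h g z) (hhm : Measurable h) (hh : Integrable h) (hgm : Measurable g)
    (hg : Integrable g) : translModulus p h z ≤ ∫⁻ x, ‖g x‖ₑ ^ p := by
  have hprod := integrable_prod_comp_add_smul hgm hg z
  have hae : ∀ᵐ x, h (x + z) - h x = ∫ t in Ioc (0 : ℝ) 1, g (x + t • z) :=
    ae_eq_of_integral_contDiff_smul_eq ((hh.comp_add_right z).sub hh).locallyIntegrable
      hprod.integral_prod_left.locallyIntegrable fun ψ hψ hψ' =>
        hw.integral_sub_eq hhm hh hgm hg hψ hψ'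
  have : IsProbabilityMeasure (volume.restrict (Ioc (0 : ℝ) 1)) := ⟨by simp⟩
  have hp0 : 0 < p := by linarith
  calc translModulus p h z = ∫⁻ x, ‖∫ t in Ioc (0 : ℝ) 1, g (x + t • z)‖ₑ ^ p :=
        lintegral_congr_ae (hae.mono fun x hx => by simp only [hx])
    _ ≤ ∫⁻ x, ∫⁻ t in Ioc (0 : ℝ) 1, ‖g (x + t • z)‖ₑ ^ p := by
        refine lintegral_mono fun x => ?_
        have hm : Measurable fun t : ℝ => g (x + t • z) := by fun_prop
        have h1 := eLpNorm'_le_eLpNorm'_of_exponent_le one_pos hp (volume.restrict (Ioc (0 : ℝ) 1))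
          (f := fun t => g (x + t • z)) hm.aestronglyMeasurable
        simp only [eLpNorm', ENNReal.rpow_one, div_one] at h1
        calc _ ≤ (∫⁻ t in Ioc (0 : ℝ) 1, ‖g (x + t • z)‖ₑ) ^ p := by
              gcongr
              exact enorm_integral_le_lintegral_enorm _
          _ ≤ _ := by
              refine (ENNReal.rpow_le_rpow h1 hp0.le).trans (le_of_eq ?_)
              rw [← ENNReal.rpow_mul, one_div_mul_cancel hp0.ne', ENNReal.rpow_one]
    _ = ∫⁻ t in Ioc (0 : ℝ) 1, ∫⁻ x, ‖g (x + t • z)‖ₑ ^ p :=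
        lintegral_lintegral_swap (by fun_prop)
    _ = ∫⁻ x, ‖g x‖ₑ ^ p := by
        simp only [lintegral_add_right_eq_self (fun x => ‖g x‖ₑ ^ p)]
        simp

/-- The derivative bounds the modulus by `‖z‖^p A` for short `z`, the norm of `h` bounds it for long
`z`; together they produce the factor `min(1, ‖z‖^p)` of `truncKernel`. -/
theorem gagliardo_le_of_weakLineDeriv {p θ : ℝ} (hp : 1 ≤ p) {h : Eucl n → ℝ}
    (hhm : Measurable h) (hh : Integrable h) {A : ℝ≥0∞}
    (hA : ∀ z, ∃ g, Measurable g ∧ Integrable g ∧ HasWeakLineDeriv h g z ∧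
      ∫⁻ x, ‖g x‖ₑ ^ p ≤ ENNReal.ofReal (‖z‖ ^ p) * A) :
    gagliardo p θ h ≤ (A + 2 ^ p * (2 * ∫⁻ x, ‖h x‖ₑ ^ p)) * ∫⁻ w : Eucl n, truncKernel p θ w := by
  rw [← lintegral_const_mul _ (measurable_truncKernel p θ)]
  refine lintegral_mono fun z => ?_
  rw [truncKernel, ← mul_assoc]
  gcongr
  rcases le_total 1 (‖z‖ ^ p) with hz | hz
  · rw [min_eq_left hz, ENNReal.ofReal_one, mul_one]
    exact (translModulus_le_norm hp hhm z).trans le_add_self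
  · obtain ⟨g, hgm, hg, hw, hgA⟩ := hA z
    rw [min_eq_right hz, mul_comm]
    refine (hw.translModulus_le hp hhm hh hgm hg).trans (hgA.trans ?_)
    gcongr
    exact le_self_add

/-! ### Derivatives of test functions and distributions -/

/-- The derivative of test functions in the direction `v`. -/
def testDeriv (v : Eucl n) : 𝓓(Ω, ℝ) →L[ℝ] 𝓓(Ω, ℝ) := TestFunction.lineDerivCLM ℝ v

/-- The derivative of distributions in the direction `v`. -/
def distDeriv (v : Eucl n) : 𝓓'(Ω, ℝ) →L[ℝ] 𝓓'(Ω, ℝ) := Distribution.lineDerivCLM v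

/-- The `i`-th vector of the standard basis. -/
abbrev stdVec (i : Fin n) : Eucl n := EuclideanSpace.single i (1 : ℝ)

@[simp]
theorem testDeriv_apply (v : Eucl n) (φ : 𝓓(Ω, ℝ)) (x : Eucl n) :
    testDeriv v φ x = lineDeriv ℝ φ x v := by
  simp [testDeriv]

theorem distDeriv_apply (v : Eucl n) (u : 𝓓'(Ω, ℝ)) (φ : 𝓓(Ω, ℝ)) :
    distDeriv v u φ = -u (testDeriv v φ) := rfl

theorem contDiff_test (φ : 𝓓(Ω, ℝ)) (m : ℕ) : ContDiff ℝ m φ :=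
  φ.contDiff.of_le (by exact_mod_cast le_top)

theorem differentiable_test (φ : 𝓓(Ω, ℝ)) : Differentiable ℝ φ :=
  φ.contDiff.differentiable (by simp)

theorem test_eq_zero_of_notMem (φ : 𝓓(Ω, ℝ)) {x : Eucl n} (hx : x ∉ (Ω : Set (Eucl n))) :
    φ x = 0 :=
  image_eq_zero_of_notMem_tsupport fun h => hx (φ.tsupport_subset h)

theorem testDeriv_comm (v w : Eucl n) (φ : 𝓓(Ω, ℝ)) :
    testDeriv v (testDeriv w φ) = testDeriv w (testDeriv v φ) := by
  have hd := differentiable_test φ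
  have h2 : Differentiable ℝ (fderiv ℝ φ) :=
    ((contDiff_test φ 2).fderiv_right (m := 1) (by norm_num)).differentiable (by norm_num)
  have key : ∀ (a b : Eucl n) (x : Eucl n),
      testDeriv a (testDeriv b φ) x = fderiv ℝ (fderiv ℝ φ) x a b := by
    intro a b x
    have e : (testDeriv b φ : Eucl n → ℝ) = fun y => fderiv ℝ φ y b := by
      ext y
      rw [testDeriv_apply, (hd y).lineDeriv_eq_fderiv]
    rw [testDeriv_apply, (differentiable_test _ x).lineDeriv_eq_fderiv, e,
      fderiv_clm_apply (h2 x) (by fun_prop)]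
    simp
  ext x
  rw [key, key]
  exact ((contDiff_test φ 2).contDiffAt.isSymmSndFDerivAt (by simp)) v w

theorem testDeriv_mulTest (v : Eucl n) (φ ψ : 𝓓(Ω, ℝ)) :
    testDeriv v (mulTest φ ψ) = mulTest (testDeriv v φ) ψ + mulTest φ (testDeriv v ψ) := by
  ext x
  have e : (mulTest φ ψ : Eucl n → ℝ) = fun y => φ y * ψ y := rfl
  have h1 := differentiable_test φ x
  have h2 := differentiable_test ψ x
  have h3 : DifferentiableAt ℝ (fun y => φ y * ψ y) x := h1.mul h2
  rw [testDeriv_apply, e, h3.lineDeriv_eq_fderiv, fderiv_fun_mul h1 h2]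
  change _ = testDeriv v φ x * ψ x + φ x * testDeriv v ψ x
  rw [testDeriv_apply, testDeriv_apply, h1.lineDeriv_eq_fderiv, h2.lineDeriv_eq_fderiv]
  simp
  ring

theorem distDeriv_comm (v w : Eucl n) (u : 𝓓'(Ω, ℝ)) :
    distDeriv v (distDeriv w u) = distDeriv w (distDeriv v u) := by
  ext φ
  simp only [distDeriv_apply, testDeriv_comm v w]

theorem distDeriv_mulDist (v : Eucl n) (φ : 𝓓(Ω, ℝ)) (u : 𝓓'(Ω, ℝ)) :
    distDeriv v (mulDist φ u) = mulDist (testDeriv v φ) u + mulDist φ (distDeriv v u) := by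
  ext ψ
  change -u (mulTest φ (testDeriv v ψ)) =
    u (mulTest (testDeriv v φ) ψ) + -u (testDeriv v (mulTest φ ψ))
  rw [testDeriv_mulTest, map_add]
  ring

theorem prod_ofFn_pow_add_single {M : Type*} [Monoid M] : ∀ {n : ℕ} (f : Fin n → M),
    (∀ i j, Commute (f i) (f j)) → ∀ (α : Fin n → ℕ) (i : Fin n),
    (List.ofFn fun j => f j ^ (α + Pi.single i 1 : Fin n → ℕ) j).prod =
      (List.ofFn fun j => f j ^ α j).prod * f i
  | 0, _, _, _, i => i.elim0
  | n + 1, f, hf, α, i => by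
    simp only [List.ofFn_succ, List.prod_cons]
    refine Fin.cases ?_ (fun i => ?_) i
    · have hc : Commute (f 0) (List.ofFn fun j : Fin n => f j.succ ^ α j.succ).prod := by
        refine Commute.list_prod_right _ _ fun x hx => ?_
        obtain ⟨j, rfl⟩ := List.mem_ofFn.1 hx
        exact (hf 0 j.succ).pow_right _
      simp [pow_succ, mul_assoc, hc.eq]
    · have ih := prod_ofFn_pow_add_single (fun j => f j.succ) (fun _ _ => hf _ _)
        (fun j => α j.succ) i
      have e : ∀ j : Fin n, (α + Pi.single i.succ 1 : Fin (n + 1) → ℕ) j.succ =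
          ((fun j : Fin n => α j.succ) + Pi.single i 1 : Fin n → ℕ) j := by
        intro j
        simp [Pi.single_apply]
      simp only [e, ih]
      simp [mul_assoc]

theorem partialD_zero (u : 𝓓'(Ω, ℝ)) : partialD Ω 0 u = u := by
  have : partialD Ω 0 = 1 := List.prod_eq_one (by simp)
  rw [this]; rfl

/-- Since the derivatives commute, any one of them may be applied first. All inductions on the order
strip off this innermost derivative. -/
theorem partialD_add_single (α : Fin n → ℕ) (i : Fin n) (u : 𝓓'(Ω, ℝ)) :
    partialD Ω (α + Pi.single i 1) u = partialD Ω α (distDeriv (stdVec i) u) := by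
  have h := prod_ofFn_pow_add_single (fun i : Fin n =>
    (distDeriv (stdVec i) : 𝓓'(Ω, ℝ) →L[ℝ] 𝓓'(Ω, ℝ)))
    (fun i j => by ext1 u; exact distDeriv_comm _ _ u) α i
  exact congrArg (fun T : 𝓓'(Ω, ℝ) →L[ℝ] 𝓓'(Ω, ℝ) => T u) h

theorem exists_eq_add_single {k : ℕ} {ν : Fin n → ℕ} (hν : ∑ i, ν i = k + 1) :
    ∃ (μ : Fin n → ℕ) (i : Fin n), ν = μ + Pi.single i 1 ∧ ∑ i, μ i = k := by
  obtain ⟨i, hi⟩ : ∃ i, ν i ≠ 0 := by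
    by_contra! h
    simp [h] at hν
  have hle : Pi.single i 1 ≤ ν := by
    intro j
    rcases eq_or_ne j i with rfl | hj
    · simpa using Nat.one_le_iff_ne_zero.2 hi
    · simp [hj]
  have e : ν = (ν - Pi.single i 1) + Pi.single i 1 := (tsub_add_cancel_of_le hle).symm
  refine ⟨ν - Pi.single i 1, i, e, ?_⟩
  have h : ∑ j, ν j = ∑ j, ((ν - Pi.single i 1) + Pi.single i 1 : Fin n → ℕ) j := by rw [← e]
  simp only [Pi.add_apply, Finset.sum_add_distrib, Finset.sum_pi_single', Finset.mem_univ,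
    if_true] at h
  omega

theorem sum_add_single (ν : Fin n → ℕ) (i : Fin n) :
    ∑ j, (ν + Pi.single i 1 : Fin n → ℕ) j = (∑ j, ν j) + 1 := by
  simp [Finset.sum_add_distrib]

theorem mem_multiIndices {k : ℕ} {ν : Fin n → ℕ} : ν ∈ multiIndices n k ↔ ∑ i, ν i = k := by
  simp [multiIndices, Finset.mem_piAntidiag]

/-! ### Test functions as distributions -/

/-- The distribution given by a test function. -/
def ofTest (ψ : 𝓓(Ω, ℝ)) : 𝓓'(Ω, ℝ) :=
  (TestFunction.integralAgainstBilinCLM (ContinuousLinearMap.mul ℝ ℝ) (vol Ω) ψ :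
    𝓓(Ω, ℝ) →L[ℝ] ℝ)

theorem represents_ofTest (ψ : 𝓓(Ω, ℝ)) : Represents ψ (ofTest ψ) := by
  intro φ
  have h : LocallyIntegrableOn ψ (Ω : Set (Eucl n)) (vol Ω) :=
    ψ.continuous.locallyIntegrable.locallyIntegrableOn _
  refine (TestFunction.integralAgainstBilinCLM_eq_integral h).trans ?_
  simp [mul_comm]

theorem represents_unique {f : Eucl n → ℝ} {u v : 𝓓'(Ω, ℝ)} (hu : Represents f u)
    (hv : Represents f v) : u = v := by
  ext φ
  rw [hu φ, hv φ]

theorem integrable_test_mul_test (φ ψ : 𝓓(Ω, ℝ)) (μ : Measure (Eucl n))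
    [IsFiniteMeasureOnCompacts μ] : Integrable (fun x => φ x * ψ x) μ :=
  (φ.continuous.mul ψ.continuous).integrable_of_hasCompactSupport ψ.hasCompactSupport.mul_left

theorem ofTest_add (φ ψ : 𝓓(Ω, ℝ)) : ofTest (φ + ψ) = ofTest φ + ofTest ψ := by
  refine represents_unique (represents_ofTest _) fun χ => ?_
  change ofTest φ χ + ofTest ψ χ = _
  rw [represents_ofTest φ χ, represents_ofTest ψ χ,
    ← integral_add (integrable_test_mul_test φ χ _) (integrable_test_mul_test ψ χ _)]
  simp [add_mul]

theorem ofTest_smul (c : ℝ) (φ : 𝓓(Ω, ℝ)) : ofTest (c • φ) = c • ofTest φ := by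
  refine represents_unique (represents_ofTest _) fun χ => ?_
  change c * ofTest φ χ = _
  rw [represents_ofTest φ χ, ← integral_const_mul]
  simp [mul_assoc]

theorem ofTest_mulTest (φ ψ : 𝓓(Ω, ℝ)) : ofTest (mulTest φ ψ) = mulDist φ (ofTest ψ) := by
  refine represents_unique (represents_ofTest _) fun χ => ?_
  rw [mulDist_apply, represents_ofTest ψ]
  congr 1; ext x; simp; ring

theorem setIntegral_eq_integral_mul_test (f : Eucl n → ℝ) (φ : 𝓓(Ω, ℝ)) :
    ∫ x in (Ω : Set (Eucl n)), f x * φ x = ∫ x, f x * φ x :=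
  setIntegral_eq_integral_of_forall_compl_eq_zero fun x hx => by
    rw [test_eq_zero_of_notMem φ hx, mul_zero]

theorem ofTest_testDeriv (v : Eucl n) (ψ : 𝓓(Ω, ℝ)) :
    ofTest (testDeriv v ψ) = distDeriv v (ofTest ψ) := by
  refine represents_unique (represents_ofTest _) fun χ => ?_
  rw [distDeriv_apply, represents_ofTest ψ, setIntegral_eq_integral_mul_test,
    setIntegral_eq_integral_mul_test]
  obtain ⟨K, hK⟩ := (contDiff_test ψ 1).lipschitzWith_of_hasCompactSupport ψ.hasCompactSupport
    one_ne_zero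
  obtain ⟨L, hL⟩ := (contDiff_test χ 1).lipschitzWith_of_hasCompactSupport χ.hasCompactSupport
    one_ne_zero
  simp only [testDeriv_apply]
  rw [hK.integral_lineDeriv_mul_eq hL χ.hasCompactSupport v, ← integral_neg]
  congr 1; ext x
  rw [lineDeriv_neg]
  ring

theorem exists_partialD_ofTest (ν : Fin n → ℕ) (ψ : 𝓓(Ω, ℝ)) :
    ∃ χ : 𝓓(Ω, ℝ), partialD Ω ν (ofTest ψ) = ofTest χ := by
  induction hk : ∑ i, ν i generalizing ν ψ with
  | zero =>
    have : ν = 0 := by ext i; simpa using (Finset.sum_eq_zero_iff.1 hk) i (Finset.mem_univ i)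
    exact ⟨ψ, by rw [this, partialD_zero]⟩
  | succ k ih =>
    obtain ⟨μ, i, rfl, hμ⟩ := exists_eq_add_single hk
    rw [partialD_add_single, ← ofTest_testDeriv]
    exact ih μ _ hμ

/-- There is a test function that equals `1` on the support of a given one. -/
theorem exists_test_eq_one (φ : 𝓓(Ω, ℝ)) :
    ∃ χ : 𝓓(Ω, ℝ), ∀ x ∈ tsupport φ, χ x = 1 := by
  obtain ⟨K, hK, hφK, hKΩ⟩ :=
    exists_compact_between φ.hasCompactSupport Ω.isOpen φ.tsupport_subset
  obtain ⟨f, hf1, hf0, -⟩ := exists_contMDiffMap_one_nhds_of_subset_interior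
    (modelWithCornersSelf ℝ (Eucl n)) (n := (⊤ : ℕ∞)) φ.hasCompactSupport.isClosed hφK
  have hts : tsupport f ⊆ K := closure_minimal (fun x hx => by
    by_contra h; exact hx (hf0 x h)) hK.isClosed
  exact ⟨⟨f, f.contMDiff.contDiff, HasCompactSupport.intro' hK hK.isClosed fun x hx => hf0 x hx, hts.trans hKΩ⟩,
    fun x hx => hf1.self_of_nhdsSet x hx⟩

theorem mulTest_eq_self {χ φ : 𝓓(Ω, ℝ)} (h : ∀ x ∈ tsupport φ, χ x = 1) : mulTest χ φ = φ := by
  ext x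
  by_cases hx : x ∈ tsupport φ
  · simp [h x hx]
  · simp [image_eq_zero_of_notMem_tsupport hx]

theorem tsupport_testDeriv_subset (v : Eucl n) (φ : 𝓓(Ω, ℝ)) :
    tsupport (testDeriv v φ) ⊆ tsupport φ := by
  have e : (testDeriv v φ : Eucl n → ℝ) = fun y => fderiv ℝ φ y v := by
    ext y
    rw [testDeriv_apply, (differentiable_test φ y).lineDeriv_eq_fderiv]
  rw [e]
  exact tsupport_fderiv_apply_subset ℝ v

/-- The derivative of `φ ψ` is supported in the support of `φ`, where `χ = 1`. This carries global
estimates over to the local spaces. -/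
theorem mulDist_distDeriv_mulDist {χ φ : 𝓓(Ω, ℝ)} (h : ∀ x ∈ tsupport φ, χ x = 1)
    (v : Eucl n) (u : 𝓓'(Ω, ℝ)) :
    mulDist φ (distDeriv v (mulDist χ u)) = mulDist φ (distDeriv v u) := by
  ext ψ
  change -u (mulTest χ (testDeriv v (mulTest φ ψ))) = -u (testDeriv v (mulTest φ ψ))
  rw [mulTest_eq_self]
  exact fun x hx => h x (tsupport_mul_subset_left (tsupport_testDeriv_subset v _ hx))

/-! ### The norms in terms of representatives -/

/-- The fundamental lemma of the calculus of variations. It lets the infima in `lpENorm` and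
`slobodeckijENorm` be computed from any single representative. -/
theorem lpReps_ae_eq {p : ℝ} (hp : 1 < p) {u : 𝓓'(Ω, ℝ)} {f g : Eucl n → ℝ}
    (hf : f ∈ lpReps p u) (hg : g ∈ lpReps p u) : f =ᵐ[vol Ω] g := by
  have hloc : LocallyIntegrableOn (f - g) (Ω : Set (Eucl n)) volume :=
    locallyIntegrableOn_of_locallyIntegrable_restrict
      ((hf.1.sub hg.1).locallyIntegrable (one_le_ofReal hp))
  have h := Ω.isOpen.ae_eq_zero_of_integral_contDiff_smul_eq_zero hloc fun ψ h1 h2 h3 => by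
    set χ : 𝓓(Ω, ℝ) := ⟨ψ, h1, h2, h3⟩
    have e : ∫ x, ψ x • (f - g) x = ∫ x, (f - g) x * χ x := by
      congr 1; ext x; exact mul_comm _ _
    rw [e, ← setIntegral_eq_integral_mul_test]
    simp only [Pi.sub_apply, sub_mul]
    rw [integral_sub (integrable_mul_test hp hf.1 χ) (integrable_mul_test hp hg.1 χ),
      ← hf.2 χ, ← hg.2 χ, sub_self]
  refine (ae_restrict_iff' Ω.isOpen.measurableSet).2 (h.mono fun x hx hxΩ => ?_)
  exact sub_eq_zero.1 (hx hxΩ)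

theorem eLpNorm_ofReal {X : Type*} [MeasurableSpace X] {μ : Measure X} {p : ℝ} (hp : 1 < p)
    (f : X → ℝ) : eLpNorm f (ENNReal.ofReal p) μ = (∫⁻ x, ‖f x‖ₑ ^ p ∂μ) ^ (1 / p) := by
  have hp0 : 0 < p := by linarith
  rw [eLpNorm_eq_lintegral_rpow_enorm_toReal (by simpa using hp0) (by simp),
    ENNReal.toReal_ofReal hp0.le]

theorem lpENorm_eq {p : ℝ} (hp : 1 < p) {u : 𝓓'(Ω, ℝ)} {f : Eucl n → ℝ} (hf : f ∈ lpReps p u) :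
    lpENorm p u = (∫⁻ x in Ω, ‖f x‖ₑ ^ p) ^ (1 / p) := by
  rw [← eLpNorm_ofReal hp]
  exact le_antisymm (iInf₂_le _ hf)
    (le_iInf₂ fun g hg => (eLpNorm_congr_ae (lpReps_ae_eq hp hf hg)).le)

theorem slobodeckijENorm_eq {p θ : ℝ} (hp : 1 < p) {u : 𝓓'(Ω, ℝ)} {f : Eucl n → ℝ}
    (hf : f ∈ lpReps p u) : slobodeckijENorm p θ u = gagliardoOn p θ Ω f ^ (1 / p) := by
  have hp0 : 0 < p := by linarith
  have e : eLpNorm (fun z : Eucl n × Eucl n =>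
      (f z.1 - f z.2) / ‖z.1 - z.2‖ ^ ((n : ℝ) / p + θ)) (ENNReal.ofReal p)
      ((vol Ω).prod (vol Ω)) = gagliardoOn p θ Ω f ^ (1 / p) := by
    rw [eLpNorm_ofReal hp, gagliardoOn]
    congr 1
    refine lintegral_congr fun z => ?_
    rw [div_eq_mul_inv, enorm_mul, ENNReal.mul_rpow_of_nonneg _ _ hp0.le]
    congr 1
    rw [gagliardoKernel, Real.enorm_of_nonneg (by positivity),
      ENNReal.ofReal_rpow_of_nonneg (by positivity) hp0.le, ← Real.rpow_neg (norm_nonneg _),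
      ← Real.rpow_mul (norm_nonneg _)]
    congr 2
    field_simp
  rw [← e]
  refine le_antisymm (iInf₂_le _ hf) (le_iInf₂ fun g hg => (eLpNorm_congr_ae ?_).le)
  have hfg := lpReps_ae_eq hp hf hg
  have h1 := Measure.quasiMeasurePreserving_fst (μ := vol Ω) (ν := vol Ω) |>.ae_eq hfg
  have h2 := Measure.quasiMeasurePreserving_snd (μ := vol Ω) (ν := vol Ω) |>.ae_eq hfg
  filter_upwards [h1, h2] with z hz1 hz2
  simp only [Function.comp_apply] at hz1 hz2
  rw [hz1, hz2]

theorem exists_measurable_rep {p : ℝ} {u : 𝓓'(Ω, ℝ)} (hu : lpENorm p u < ∞) :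
    ∃ f ∈ lpReps p u, Measurable f := by
  have hne : (lpReps p u).Nonempty := by
    by_contra h
    rw [not_nonempty_iff_eq_empty] at h
    simp [lpENorm, h] at hu
  obtain ⟨f, hf, hf'⟩ := hne
  have hae := hf.1.ae_eq_mk
  refine ⟨hf.1.mk f, ⟨(memLp_congr_ae hae).1 hf, fun φ => ?_⟩,
    hf.1.stronglyMeasurable_mk.measurable⟩
  rw [hf' φ]
  exact integral_congr_ae (hae.mono fun x hx => by simp only [hx])

theorem rpow_one_div_le_iff {p : ℝ} (hp : 1 < p) {a b : ℝ≥0∞} : a ^ (1 / p) ≤ b ↔ a ≤ b ^ p := by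
  rw [one_div]
  exact ENNReal.rpow_inv_le_iff (by linarith)

theorem lpENorm_ofTest_lt_top {p : ℝ} (ψ : 𝓓(Ω, ℝ)) :
    lpENorm p (ofTest ψ) < ∞ := by
  have h : MemLp ψ (ENNReal.ofReal p) (vol Ω) :=
    ψ.continuous.memLp_of_hasCompactSupport ψ.hasCompactSupport
  exact (iInf₂_le _ ⟨h, represents_ofTest ψ⟩).trans_lt h.eLpNorm_lt_top

/-! ### Multiplication by a test function: the basic estimates -/

theorem exists_lintegral_test_mul_le {p : ℝ} (hp : 1 < p) (φ : 𝓓(Ω, ℝ)) :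
    ∃ C : ℝ≥0, ∀ f : Eucl n → ℝ,
      ∫⁻ x, ‖φ x * f x‖ₑ ^ p ≤ C * ∫⁻ x in Ω, ‖f x‖ₑ ^ p := by
  have hp0 : 0 < p := by linarith
  obtain ⟨M, hM⟩ := φ.continuous.bounded_above_of_compact_support φ.hasCompactSupport
  have hM : ∀ x, ‖φ x‖ₑ ≤ M.toNNReal := fun x => by
    rw [← ofReal_norm]; exact ENNReal.ofReal_le_ofReal (hM x)
  refine ⟨M.toNNReal ^ p, fun f => ?_⟩
  rw [← lintegral_indicator Ω.isOpen.measurableSet, ← lintegral_const_mul' _ _ (by simp)]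
  refine lintegral_mono fun x => ?_
  by_cases hx : x ∈ (Ω : Set (Eucl n))
  · rw [indicator_of_mem hx, enorm_mul, ENNReal.mul_rpow_of_nonneg _ _ hp0.le,
      ENNReal.coe_rpow_of_nonneg _ hp0.le]
    gcongr
    exact hM x
  · simp [test_eq_zero_of_notMem φ hx, hp0]

theorem mul_mem_lpReps {p : ℝ} (φ : 𝓓(Ω, ℝ)) {u : 𝓓'(Ω, ℝ)} {f : Eucl n → ℝ}
    (hf : f ∈ lpReps p u) : (fun x => φ x * f x) ∈ lpReps p (mulDist φ u) := by
  refine ⟨hf.1.mul φ.memLp_top, fun ψ => ?_⟩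
  rw [mulDist_apply, hf.2]
  congr 1; ext x; simp; ring

theorem rpow_le_of_lpENorm_le {p : ℝ} (hp : 1 < p) {u : 𝓓'(Ω, ℝ)} {f : Eucl n → ℝ}
    (hf : f ∈ lpReps p u) {A : ℝ≥0∞} (hA : lpENorm p u ≤ A) :
    ∫⁻ x in Ω, ‖f x‖ₑ ^ p ≤ A ^ p := by
  rwa [lpENorm_eq hp hf, rpow_one_div_le_iff hp] at hA

theorem coe_mul_rpow_le {p : ℝ} (hp : 1 < p) (C A : ℝ≥0) :
    (C * (A : ℝ≥0∞) ^ p) ^ (1 / p) = ((C ^ (1 / p) : ℝ≥0) : ℝ≥0∞) * A := by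
  have hp0 : 0 < p := by linarith
  rw [ENNReal.mul_rpow_of_nonneg _ _ (by positivity), ← ENNReal.rpow_mul,
    mul_one_div_cancel hp0.ne', ENNReal.rpow_one, ENNReal.coe_rpow_of_nonneg _ (by positivity)]

/-- The bound is stated through a finite majorant `A` of the norm, here and below: finiteness then
provides a representative, and the value `∞` never has to be multiplied. -/
theorem exists_lpENorm_mulDist_le {p : ℝ} (hp : 1 < p) (φ : 𝓓(Ω, ℝ)) :
    ∃ C : ℝ≥0, ∀ (u : 𝓓'(Ω, ℝ)) (A : ℝ≥0), lpENorm p u ≤ A → lpENorm p (mulDist φ u) ≤ C * A := by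
  obtain ⟨C, hC⟩ := exists_lintegral_test_mul_le hp φ
  refine ⟨C ^ (1 / p), fun u A hA => ?_⟩
  obtain ⟨f, hf, -⟩ := exists_measurable_rep (hA.trans_lt ENNReal.coe_lt_top)
  rw [lpENorm_eq hp (mul_mem_lpReps φ hf), ← coe_mul_rpow_le hp]
  refine ENNReal.rpow_le_rpow ?_ (by positivity)
  refine (setLIntegral_le_lintegral _ _).trans ((hC f).trans ?_)
  gcongr
  exact rpow_le_of_lpENorm_le hp hf hA

/-- The left side is kept on all of `ℝⁿ` because the pairing estimate `exists_integral_lineDeriv_le`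
translates functions freely. -/
theorem exists_gagliardo_mul_rep_le (hn : 0 < n) {p θ : ℝ} (hp : 1 < p) (hθ0 : 0 < θ)
    (hθ1 : θ < 1) (φ : 𝓓(Ω, ℝ)) :
    ∃ C : ℝ≥0, ∀ (u : 𝓓'(Ω, ℝ)) (A : ℝ≥0) (f : Eucl n → ℝ), f ∈ lpReps p u → Measurable f →
      lpENorm p u ≤ A → slobodeckijENorm p θ u ≤ A →
      gagliardo p θ (fun x => φ x * f x) ≤ C * (A : ℝ≥0∞) ^ p := by
  obtain ⟨C, hC⟩ := exists_gagliardo_mul_le hn hp hθ0 hθ1 Ω.isOpen.measurableSet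
    (contDiff_test φ 1) φ.hasCompactSupport fun x hx => test_eq_zero_of_notMem φ hx
  refine ⟨C * 2, fun u A f hf hfm h1 h2 => ?_⟩
  refine (hC f hfm).trans ?_
  rw [slobodeckijENorm_eq hp hf, rpow_one_div_le_iff hp] at h2
  calc _ ≤ C * ((A : ℝ≥0∞) ^ p + (A : ℝ≥0∞) ^ p) := by
        gcongr
        exact rpow_le_of_lpENorm_le hp hf h1
    _ = _ := by push_cast; ring

theorem slobodeckijENorm_le_of_gagliardo_le {p θ : ℝ} (hp : 1 < p) {u : 𝓓'(Ω, ℝ)}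
    {f : Eucl n → ℝ} (hf : f ∈ lpReps p u) (hfm : Measurable f) {C A : ℝ≥0}
    (h : gagliardo p θ f ≤ C * (A : ℝ≥0∞) ^ p) :
    slobodeckijENorm p θ u ≤ ((C ^ (1 / p) : ℝ≥0) : ℝ≥0∞) * A := by
  rw [slobodeckijENorm_eq hp hf, ← coe_mul_rpow_le hp]
  exact ENNReal.rpow_le_rpow ((gagliardoOn_le hfm _).trans h) (by positivity)

theorem exists_slobodeckijENorm_mulDist_le (hn : 0 < n) {p θ : ℝ} (hp : 1 < p) (hθ0 : 0 < θ)
    (hθ1 : θ < 1) (φ : 𝓓(Ω, ℝ)) :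
    ∃ C : ℝ≥0, ∀ (u : 𝓓'(Ω, ℝ)) (A : ℝ≥0), lpENorm p u ≤ A → slobodeckijENorm p θ u ≤ A →
      slobodeckijENorm p θ (mulDist φ u) ≤ C * A := by
  obtain ⟨C, hC⟩ := exists_gagliardo_mul_rep_le hn hp hθ0 hθ1 φ
  refine ⟨C ^ (1 / p), fun u A h1 h2 => ?_⟩
  obtain ⟨f, hf, hfm⟩ := exists_measurable_rep (h1.trans_lt ENNReal.coe_lt_top)
  exact slobodeckijENorm_le_of_gagliardo_le hp (mul_mem_lpReps φ hf)
    (φ.continuous.measurable.mul hfm) (hC u A f hf hfm h1 h2)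

theorem integrable_test_mul_rep {p : ℝ} (hp : 1 < p) (φ : 𝓓(Ω, ℝ)) {u : 𝓓'(Ω, ℝ)}
    {f : Eucl n → ℝ} (hf : f ∈ lpReps p u) : Integrable fun x => φ x * f x := by
  have h : IntegrableOn (fun x => φ x * f x) (Ω : Set (Eucl n)) :=
    (integrable_mul_test hp hf.1 φ).congr (.of_forall fun x => mul_comm _ _)
  refine (integrableOn_iff_integrable_of_support_subset fun x hx => ?_).1 h
  by_contra hx'
  exact hx (by simp [test_eq_zero_of_notMem φ hx'])

/-- Product of a smooth function with a test function. -/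
def smoothMulTest {ψ : Eucl n → ℝ} (hψ : ContDiff ℝ (⊤ : ℕ∞) ψ) (φ : 𝓓(Ω, ℝ)) : 𝓓(Ω, ℝ) :=
  ⟨fun x => φ x * ψ x, φ.contDiff.mul hψ, φ.hasCompactSupport.mul_right,
    tsupport_mul_subset_left.trans φ.tsupport_subset⟩

/-- For smooth `ψ` on `ℝⁿ` the product `φ ψ` is a test function on `Ω`. Testing the derivative of
`u` with it gives a weak derivative of the zero extension on all of `ℝⁿ`. -/
theorem hasWeakLineDeriv_test_mul_rep {p : ℝ} (hp : 1 < p) (φ : 𝓓(Ω, ℝ)) (v : Eucl n)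
    {u : 𝓓'(Ω, ℝ)} {f g : Eucl n → ℝ} (hf : f ∈ lpReps p u) (hg : g ∈ lpReps p (distDeriv v u)) :
    HasWeakLineDeriv (fun x => φ x * f x) (fun x => φ x * g x + testDeriv v φ x * f x) v := by
  intro ψ hψ hψ'
  obtain ⟨M, hM⟩ := hψ.continuous.bounded_above_of_compact_support hψ'
  have hψm := hψ.continuous.measurable
  have hbdd : ∀ {h : Eucl n → ℝ}, Integrable h → Integrable fun x => ψ x * h x :=
    fun hh => hh.bdd_mul (c := M) hψm.aestronglyMeasurable (.of_forall hM)
  have hψd : Differentiable ℝ ψ := hψ.differentiable (by simp)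
  have hder : ∀ x, lineDeriv ℝ (fun y => φ y * ψ y) x v =
      testDeriv v φ x * ψ x + φ x * lineDeriv ℝ ψ x v := by
    intro x
    have h1 := differentiable_test φ x
    have h3 : DifferentiableAt ℝ (fun y => φ y * ψ y) x := h1.mul (hψd x)
    rw [testDeriv_apply, h3.lineDeriv_eq_fderiv, fderiv_fun_mul h1 (hψd x),
      h1.lineDeriv_eq_fderiv, (hψd x).lineDeriv_eq_fderiv]
    simp
    ring
  have e := hg.2 (smoothMulTest hψ φ)
  rw [distDeriv_apply, hf.2, setIntegral_eq_integral_mul_test,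
    setIntegral_eq_integral_mul_test] at e
  have i1 : Integrable fun x => f x * testDeriv v (smoothMulTest hψ φ) x :=
    (integrable_test_mul_rep hp (testDeriv v (smoothMulTest hψ φ)) hf).congr
      (.of_forall fun x => mul_comm _ _)
  have i2 := hbdd (integrable_test_mul_rep hp (testDeriv v φ) hf)
  have i3 := hbdd (integrable_test_mul_rep hp φ hg)
  calc _ = ∫ x, (f x * testDeriv v (smoothMulTest hψ φ) x - ψ x * (testDeriv v φ x * f x)) := by
        congr 1; ext x
        rw [testDeriv_apply]
        change _ = f x * lineDeriv ℝ (fun y => φ y * ψ y) x v - _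
        rw [hder]
        ring
    _ = -(∫ x, g x * (smoothMulTest hψ φ) x) - ∫ x, ψ x * (testDeriv v φ x * f x) := by
        rw [integral_sub i1 i2, ← e, neg_neg]
    _ = -((∫ x, ψ x * (φ x * g x)) + ∫ x, ψ x * (testDeriv v φ x * f x)) := by
        rw [neg_add, ← sub_eq_add_neg]
        congr 3; ext x
        change g x * (φ x * ψ x) = _
        ring
    _ = _ := by
        rw [← integral_add i3 i2]
        congr 2; ext x; ring

theorem hasWeakLineDeriv_sum {h : Eucl n → ℝ} {g : Fin n → Eucl n → ℝ} (hh : Integrable h)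
    (hg : ∀ i, Integrable (g i)) (hw : ∀ i, HasWeakLineDeriv h (g i) (stdVec i)) (z : Eucl n) :
    HasWeakLineDeriv h (fun x => ∑ i, z i * g i x) z := by
  intro ψ hψ hψ'
  obtain ⟨M, hM⟩ := hψ.continuous.bounded_above_of_compact_support hψ'
  have hψ1 : ContDiff ℝ 1 ψ := hψ.of_le (by exact_mod_cast le_top)
  obtain ⟨K, hK⟩ := hψ1.lipschitzWith_of_hasCompactSupport hψ' one_ne_zero
  have hψd : Differentiable ℝ ψ := hψ.differentiable (by simp)
  have hz : z = ∑ i, z i • stdVec i := by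
    ext j
    simp [stdVec, Finset.sum_apply, Pi.single_apply]
  have hder : ∀ x, lineDeriv ℝ ψ x z = ∑ i, z i * lineDeriv ℝ ψ x (stdVec i) := by
    intro x
    simp only [(hψd x).lineDeriv_eq_fderiv]
    conv_lhs => rw [hz]
    simp
  simp only [hder, Finset.sum_mul, Finset.mul_sum]
  rw [integral_finsetSum _ fun i _ => ?_, integral_finsetSum _ fun i _ => ?_,
    ← Finset.sum_neg_distrib]
  · refine Finset.sum_congr rfl fun i _ => ?_
    calc _ = z i * ∫ x, lineDeriv ℝ ψ x (stdVec i) * h x := by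
          rw [← integral_const_mul]; congr 1; ext x; ring
      _ = _ := by
          rw [hw i ψ hψ hψ', mul_neg, ← integral_const_mul]; congr 2; ext x; ring
  · have := ((hg i).bdd_mul (c := M) hψ.continuous.aestronglyMeasurable
      (.of_forall hM)).const_mul (z i)
    exact this.congr (.of_forall fun x => by ring)
  · have := (hh.bdd_mul (c := K * ‖(stdVec i : Eucl n)‖)
      (measurable_lineDeriv hψ.continuous).aestronglyMeasurable
      (.of_forall fun x => norm_lineDeriv_le_of_lipschitz ℝ hK)).const_mul (z i)
    exact this.congr (.of_forall fun x => by ring)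

theorem lintegral_sum_mul_rpow_le {p : ℝ} (hp : 1 < p) {g : Fin n → Eucl n → ℝ}
    (hg : ∀ i, Measurable (g i)) (z : Eucl n) :
    ∫⁻ x, ‖∑ i, z i * g i x‖ₑ ^ p ≤ ENNReal.ofReal (‖z‖ ^ p) *
      ((n : ℝ≥0∞) ^ (p - 1) * ∑ i, ∫⁻ x, ‖g i x‖ₑ ^ p) := by
  have hp0 : 0 < p := by linarith
  rw [← lintegral_finsetSum _ fun i _ => by have := hg i; fun_prop,
    ← lintegral_const_mul _ (Finset.measurable_sum _ fun i _ => by have := hg i; fun_prop),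
    ← lintegral_const_mul _ ((Finset.measurable_sum _ fun i _ => by
      have := hg i; fun_prop).const_mul _)]
  refine lintegral_mono fun x => ?_
  have h1 : ‖∑ i, z i * g i x‖ₑ ≤ ENNReal.ofReal ‖z‖ * ∑ i, ‖g i x‖ₑ := by
    refine (enorm_sum_le _ _).trans ?_
    rw [Finset.mul_sum]
    refine Finset.sum_le_sum fun i _ => ?_
    rw [enorm_mul, ← ofReal_norm (z i)]
    gcongr
    exact PiLp.norm_apply_le z i
  refine (ENNReal.rpow_le_rpow h1 hp0.le).trans ?_
  rw [ENNReal.mul_rpow_of_nonneg _ _ hp0.le, ENNReal.ofReal_rpow_of_nonneg (norm_nonneg _) hp0.le]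
  gcongr
  simpa using ENNReal.rpow_sum_le_const_mul_sum_rpow Finset.univ (fun i => ‖g i x‖ₑ) hp.le

/-- On functions with `p`-integrable first derivatives, the product with a test function has a
finite Slobodeckij seminorm of every order less than `1`. -/
theorem exists_slobodeckijENorm_mulDist_le_of_deriv (hn : 0 < n) {p θ : ℝ} (hp : 1 < p)
    (hθ0 : 0 < θ) (hθ1 : θ < 1) (φ : 𝓓(Ω, ℝ)) :
    ∃ C : ℝ≥0, ∀ (u : 𝓓'(Ω, ℝ)) (A : ℝ≥0), lpENorm p u ≤ A →
      (∀ i, lpENorm p (distDeriv (stdVec i) u) ≤ A) →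
      slobodeckijENorm p θ (mulDist φ u) ≤ C * A := by
  have hp0 : 0 < p := by linarith
  obtain ⟨C₀, hC₀⟩ := exists_lintegral_test_mul_le hp φ
  choose C₁ hC₁ using fun i : Fin n => exists_lintegral_test_mul_le hp (testDeriv (stdVec i) φ)
  set I := ∫⁻ w : Eucl n, truncKernel p θ w
  have hIt : I ≠ ∞ := (lintegral_truncKernel_lt_top hn hp0 hθ0 hθ1).ne
  -- The first summand comes from the gradient of `φ f`, the second from `φ f` itself, as in
  -- `gagliardo_le_of_weakLineDeriv`.
  set D : ℝ≥0∞ := ((n : ℝ≥0∞) ^ (p - 1) * ∑ i, 2 ^ p * ((C₀ : ℝ≥0∞) + C₁ i) + 2 ^ p * (2 * C₀)) * I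
    with hD
  have h2t : (2 : ℝ≥0∞) ^ p ≠ ∞ := ENNReal.rpow_ne_top_of_nonneg hp0.le (by simp)
  have hDt : D ≠ ∞ := by
    refine ENNReal.mul_ne_top (ENNReal.add_ne_top.2 ⟨ENNReal.mul_ne_top ?_ ?_,
      ENNReal.mul_ne_top h2t (ENNReal.mul_ne_top (by simp) (by simp))⟩) hIt
    · exact ENNReal.rpow_ne_top_of_nonneg (by linarith) (by simp)
    · exact (ENNReal.sum_lt_top.2 fun i _ => (ENNReal.mul_ne_top h2t (by simp)).lt_top).ne
  refine ⟨D.toNNReal ^ (1 / p), fun u A hA hA' => ?_⟩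
  obtain ⟨f, hf, hfm⟩ := exists_measurable_rep (hA.trans_lt ENNReal.coe_lt_top)
  choose g hg hgm using fun i => exists_measurable_rep ((hA' i).trans_lt ENNReal.coe_lt_top)
  have hφm := φ.continuous.measurable
  have hφm' := fun i : Fin n => (testDeriv (stdVec i) φ).continuous.measurable
  set G : Fin n → Eucl n → ℝ := fun i x => φ x * g i x + testDeriv (stdVec i) φ x * f x with hG
  have hGm : ∀ i, Measurable (G i) := fun i =>
    (hφm.mul (hgm i)).add ((hφm' i).mul hfm)
  have hh := integrable_test_mul_rep hp φ hf
  have hGi : ∀ i, Integrable (G i) := fun i =>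
    (integrable_test_mul_rep hp φ (hg i)).add (integrable_test_mul_rep hp (testDeriv (stdVec i) φ) hf)
  have hGA : ∀ i, ∫⁻ x, ‖G i x‖ₑ ^ p ≤ 2 ^ p * ((C₀ : ℝ≥0∞) + C₁ i) * (A : ℝ≥0∞) ^ p := by
    intro i
    have m1 : Measurable fun x => ‖φ x * g i x‖ₑ ^ p := by have := hgm i; fun_prop
    have m2 : Measurable fun x => ‖testDeriv (stdVec i) φ x * f x‖ₑ ^ p := by
      have := hφm' i; fun_prop
    calc _ ≤ ∫⁻ x, 2 ^ p * (‖φ x * g i x‖ₑ ^ p + ‖testDeriv (stdVec i) φ x * f x‖ₑ ^ p) :=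
          lintegral_mono fun x => enorm_add_rpow_le hp.le _ _
      _ = 2 ^ p * ((∫⁻ x, ‖φ x * g i x‖ₑ ^ p) +
            ∫⁻ x, ‖testDeriv (stdVec i) φ x * f x‖ₑ ^ p) := by
          rw [lintegral_const_mul' _ _ h2t, lintegral_add_left m1]
      _ ≤ 2 ^ p * (C₀ * (A : ℝ≥0∞) ^ p + C₁ i * (A : ℝ≥0∞) ^ p) := by
          gcongr
          · exact (hC₀ _).trans (by gcongr; exact rpow_le_of_lpENorm_le hp (hg i) (hA' i))
          · exact (hC₁ i _).trans (by gcongr; exact rpow_le_of_lpENorm_le hp hf hA)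
      _ = _ := by ring
  have hmain := gagliardo_le_of_weakLineDeriv (θ := θ) hp.le (hφm.mul hfm) hh
    (A := (n : ℝ≥0∞) ^ (p - 1) * ∑ i, 2 ^ p * ((C₀ : ℝ≥0∞) + C₁ i) * (A : ℝ≥0∞) ^ p)
    fun z => ⟨fun x => ∑ i, z i * G i x,
      Finset.measurable_sum _ fun i _ => (hGm i).const_mul _,
      integrable_finsetSum _ fun i _ => (hGi i).const_mul _,
      hasWeakLineDeriv_sum hh hGi
        (fun i => hasWeakLineDeriv_test_mul_rep hp φ (stdVec i) hf (hg i)) z,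
      (lintegral_sum_mul_rpow_le hp hGm z).trans (by
        gcongr with i
        exact hGA i)⟩
  refine slobodeckijENorm_le_of_gagliardo_le hp (mul_mem_lpReps φ hf) (hφm.mul hfm) ?_
  rw [ENNReal.coe_toNNReal hDt]
  refine hmain.trans ?_
  calc _ ≤ ((n : ℝ≥0∞) ^ (p - 1) * ∑ i, 2 ^ p * ((C₀ : ℝ≥0∞) + C₁ i) * (A : ℝ≥0∞) ^ p +
        2 ^ p * (2 * (C₀ * (A : ℝ≥0∞) ^ p))) * I := by
        gcongr
        exact (hC₀ f).trans (by gcongr; exact rpow_le_of_lpENorm_le hp hf hA)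
    _ = _ := by
        rw [hD, ← Finset.sum_mul]
        ring

/-! ### Multiplication by a test function on `W^{s,p}(Ω)`, `s ≥ 0` -/

/-- All derivatives of `u` of order at most `k` have `L^p` norm at most `A`. -/
def DerivsLe (p : ℝ) (k : ℕ) (u : 𝓓'(Ω, ℝ)) (A : ℝ≥0) : Prop :=
  ∀ ν : Fin n → ℕ, ∑ i, ν i ≤ k → lpENorm p (partialD Ω ν u) ≤ A

theorem DerivsLe.mono {p : ℝ} {k l : ℕ} (hkl : l ≤ k) {u : 𝓓'(Ω, ℝ)} {A : ℝ≥0}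
    (h : DerivsLe p k u A) : DerivsLe p l u A := fun ν hν => h ν (hν.trans hkl)

theorem DerivsLe.distDeriv {p : ℝ} {k : ℕ} {u : 𝓓'(Ω, ℝ)} {A : ℝ≥0}
    (h : DerivsLe p (k + 1) u A) (i : Fin n) : DerivsLe p k (distDeriv (stdVec i) u) A := by
  intro ν hν
  rw [← partialD_add_single]
  exact h _ (by rw [sum_add_single]; omega)

theorem DerivsLe.lpENorm_le {p : ℝ} {k : ℕ} {u : 𝓓'(Ω, ℝ)} {A : ℝ≥0}
    (h : DerivsLe p k u A) : lpENorm p u ≤ A := by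
  simpa [partialD_zero] using h 0 (by simp)

/-- Leibniz rule for subadditive functionals `S` on distributions: a bound of `S(φ u)` for all `φ`
gives bounds of `S(∂^ν(φ u))`. -/
theorem exists_partialD_mulDist_le {S : 𝓓'(Ω, ℝ) → ℝ≥0∞} (hS : ∀ u v, S (u + v) ≤ S u + S v)
    {H : ℕ → 𝓓'(Ω, ℝ) → ℝ≥0 → Prop}
    (hbase : ∀ φ : 𝓓(Ω, ℝ), ∃ C : ℝ≥0, ∀ u A, H 0 u A → S (mulDist φ u) ≤ C * A)
    (hlow : ∀ k (φ : 𝓓(Ω, ℝ)) (ν : Fin n → ℕ), ∑ i, ν i = k →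
      (∃ C : ℝ≥0, ∀ u A, H k u A → S (partialD Ω ν (mulDist φ u)) ≤ C * A) →
      ∃ C : ℝ≥0, ∀ u A, H (k + 1) u A → S (partialD Ω ν (mulDist φ u)) ≤ C * A)
    (hderiv : ∀ k u A, H (k + 1) u A → ∀ i, H k (distDeriv (stdVec i) u) A)
    (φ : 𝓓(Ω, ℝ)) (ν : Fin n → ℕ) :
    ∃ C : ℝ≥0, ∀ u A, H (∑ i, ν i) u A → S (partialD Ω ν (mulDist φ u)) ≤ C * A := by
  induction hk : ∑ i, ν i generalizing ν φ with
  | zero =>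
    have : ν = 0 := by ext i; simpa using (Finset.sum_eq_zero_iff.1 hk) i (Finset.mem_univ i)
    simpa only [this, partialD_zero] using hbase φ
  | succ k ih =>
    obtain ⟨μ, i, rfl, hμ⟩ := exists_eq_add_single hk
    -- In `∂ᵢ(φ u) = (∂ᵢφ) u + φ ∂ᵢu` the first term carries one derivative fewer than the
    -- hypothesis on `u` allows, which is the situation of `hlow`. The second is the induction
    -- hypothesis for `∂ᵢu`.
    obtain ⟨C₁, hC₁⟩ := hlow k (testDeriv (stdVec i) φ) μ hμ (ih _ μ hμ)
    obtain ⟨C₂, hC₂⟩ := ih φ μ hμ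
    refine ⟨C₁ + C₂, fun u A hA => ?_⟩
    rw [partialD_add_single, distDeriv_mulDist, map_add, ENNReal.coe_add, add_mul]
    exact (hS _ _).trans (add_le_add (hC₁ u A hA) (hC₂ _ A (hderiv k u A hA i)))

theorem exists_lpENorm_partialD_mulDist_le {p : ℝ} (hp : 1 < p) (φ : 𝓓(Ω, ℝ)) (ν : Fin n → ℕ) :
    ∃ C : ℝ≥0, ∀ u A, DerivsLe p (∑ i, ν i) u A →
      lpENorm p (partialD Ω ν (mulDist φ u)) ≤ C * A := by
  refine exists_partialD_mulDist_le (lpENorm_add hp) (fun φ => ?_) (fun k φ ν _ h => ?_)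
    (fun k u A h i => h.distDeriv i) φ ν
  · obtain ⟨C, hC⟩ := exists_lpENorm_mulDist_le hp φ
    exact ⟨C, fun u A h => hC u A h.lpENorm_le⟩
  · obtain ⟨C, hC⟩ := h
    exact ⟨C, fun u A h => hC u A (h.mono k.le_succ)⟩

theorem exists_slobodeckijENorm_partialD_mulDist_le_of_deriv (hn : 0 < n) {p θ : ℝ} (hp : 1 < p)
    (hθ0 : 0 < θ) (hθ1 : θ < 1) (φ : 𝓓(Ω, ℝ)) (ν : Fin n → ℕ) :
    ∃ C : ℝ≥0, ∀ u A, DerivsLe p (∑ i, ν i + 1) u A →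
      slobodeckijENorm p θ (partialD Ω ν (mulDist φ u)) ≤ C * A := by
  refine exists_partialD_mulDist_le (H := fun k => DerivsLe p (k + 1)) (slobodeckijENorm_add hp)
    (fun φ => ?_) (fun k φ ν _ h => ?_) (fun k u A h i => h.distDeriv i) φ ν
  · obtain ⟨C, hC⟩ := exists_slobodeckijENorm_mulDist_le_of_deriv hn hp hθ0 hθ1 φ
    exact ⟨C, fun u A h => hC u A h.lpENorm_le fun i => (h.distDeriv i).lpENorm_le⟩
  · obtain ⟨C, hC⟩ := h
    exact ⟨C, fun u A h => hC u A (h.mono (by omega))⟩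

/-- The norm contains Slobodeckij seminorms only at top order. Terms with a derivative on `φ`
involve lower orders, where the seminorm is recovered from one more `L^p` derivative; `hlow` is
therefore proved from `exists_slobodeckijENorm_partialD_mulDist_le_of_deriv` and not from the
induction hypothesis. -/
theorem exists_slobodeckijENorm_partialD_mulDist_le (hn : 0 < n) {p θ : ℝ} (hp : 1 < p)
    (hθ0 : 0 < θ) (hθ1 : θ < 1) (φ : 𝓓(Ω, ℝ)) (ν : Fin n → ℕ) :
    ∃ C : ℝ≥0, ∀ u A, (DerivsLe p (∑ i, ν i) u A ∧ ∀ μ : Fin n → ℕ, ∑ i, μ i = ∑ i, ν i →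
        slobodeckijENorm p θ (partialD Ω μ u) ≤ A) →
      slobodeckijENorm p θ (partialD Ω ν (mulDist φ u)) ≤ C * A := by
  refine exists_partialD_mulDist_le (H := fun k u A => DerivsLe p k u A ∧
    ∀ μ : Fin n → ℕ, ∑ i, μ i = k → slobodeckijENorm p θ (partialD Ω μ u) ≤ A)
    (slobodeckijENorm_add hp) (fun φ => ?_) (fun k φ ν hν _ => ?_) (fun k u A h i => ?_) φ ν
  · obtain ⟨C, hC⟩ := exists_slobodeckijENorm_mulDist_le hn hp hθ0 hθ1 φ
    refine ⟨C, fun u A h => hC u A h.1.lpENorm_le ?_⟩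
    simpa [partialD_zero] using h.2 0 (by simp)
  · obtain ⟨C, hC⟩ :=
      exists_slobodeckijENorm_partialD_mulDist_le_of_deriv hn hp hθ0 hθ1 φ ν
    exact ⟨C, fun u A h => hC u A (by rw [hν]; exact h.1)⟩
  · refine ⟨h.1.distDeriv i, fun μ hμ => ?_⟩
    rw [← partialD_add_single]
    exact h.2 _ (by rw [sum_add_single, hμ])

/-! ### From estimates of single terms to estimates of the whole norm -/

theorem lpENorm_le_sobolevENormNonneg {s p : ℝ} (u : 𝓓'(Ω, ℝ)) {ν : Fin n → ℕ}
    (hν : ∑ i, ν i ≤ ⌊s⌋₊) : lpENorm p (partialD Ω ν u) ≤ sobolevENormNonneg s p u := by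
  refine le_trans ?_ le_self_add
  refine le_trans ?_ (Finset.single_le_sum (fun _ _ => zero_le)
    (Finset.mem_range.2 (Nat.lt_succ_of_le hν)))
  exact Finset.single_le_sum (f := fun ν => lpENorm p (partialD Ω ν u)) (fun _ _ => zero_le)
    (mem_multiIndices.2 rfl)

theorem slobodeckijENorm_le_sobolevENormNonneg {s p : ℝ} (hs : Int.fract s ≠ 0) (u : 𝓓'(Ω, ℝ))
    {ν : Fin n → ℕ} (hν : ∑ i, ν i = ⌊s⌋₊) :
    slobodeckijENorm p (Int.fract s) (partialD Ω ν u) ≤ sobolevENormNonneg s p u := by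
  refine le_trans ?_ le_add_self
  rw [if_neg hs]
  exact Finset.single_le_sum
    (f := fun ν => slobodeckijENorm p (Int.fract s) (partialD Ω ν u)) (fun _ _ => zero_le)
    (mem_multiIndices.2 hν)

/-- A bound of all terms of the norm gives a bound of the norm. -/
theorem exists_sobolevENormNonneg_le_of_terms_le {s p : ℝ} {R : 𝓓'(Ω, ℝ) → ℝ≥0 → Prop}
    {T : 𝓓'(Ω, ℝ) → 𝓓'(Ω, ℝ)}
    (h1 : ∀ ν : Fin n → ℕ, ∑ i, ν i ≤ ⌊s⌋₊ → ∃ C : ℝ≥0, ∀ u A, R u A →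
      lpENorm p (partialD Ω ν (T u)) ≤ C * A)
    (h2 : Int.fract s ≠ 0 → ∀ ν : Fin n → ℕ, ∑ i, ν i = ⌊s⌋₊ → ∃ C : ℝ≥0, ∀ u A, R u A →
      slobodeckijENorm p (Int.fract s) (partialD Ω ν (T u)) ≤ C * A) :
    ∃ C : ℝ≥0, ∀ u A, R u A → sobolevENormNonneg s p (T u) ≤ C * A := by
  have h1' : ∀ ν : Fin n → ℕ, ∃ C : ℝ≥0, ∑ i, ν i ≤ ⌊s⌋₊ → ∀ u A, R u A →
      lpENorm p (partialD Ω ν (T u)) ≤ C * A := fun ν => by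
    by_cases hν : ∑ i, ν i ≤ ⌊s⌋₊
    · exact (h1 ν hν).imp fun C hC _ => hC
    · exact ⟨0, fun h => absurd h hν⟩
  choose C₁ hC₁ using h1'
  by_cases hs : Int.fract s = 0
  · refine ⟨∑ j ∈ Finset.range (⌊s⌋₊ + 1), ∑ ν ∈ multiIndices n j, C₁ ν, fun u A hR => ?_⟩
    rw [sobolevENormNonneg, if_pos hs, add_zero]
    push_cast
    simp only [Finset.sum_mul]
    refine Finset.sum_le_sum fun j hj => Finset.sum_le_sum fun ν hν => hC₁ ν ?_ u A hR
    rw [mem_multiIndices.1 hν]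
    exact Nat.lt_succ_iff.1 (Finset.mem_range.1 hj)
  · have h2' : ∀ ν : Fin n → ℕ, ∃ C : ℝ≥0, ∑ i, ν i = ⌊s⌋₊ → ∀ u A, R u A →
        slobodeckijENorm p (Int.fract s) (partialD Ω ν (T u)) ≤ C * A := fun ν => by
      by_cases hν : ∑ i, ν i = ⌊s⌋₊
      · exact (h2 hs ν hν).imp fun C hC _ => hC
      · exact ⟨0, fun h => absurd h hν⟩
    choose C₂ hC₂ using h2'
    refine ⟨(∑ j ∈ Finset.range (⌊s⌋₊ + 1), ∑ ν ∈ multiIndices n j, C₁ ν) +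
      ∑ ν ∈ multiIndices n ⌊s⌋₊, C₂ ν, fun u A hR => ?_⟩
    rw [sobolevENormNonneg, if_neg hs]
    push_cast
    simp only [add_mul, Finset.sum_mul]
    refine add_le_add (Finset.sum_le_sum fun j hj => Finset.sum_le_sum fun ν hν => hC₁ ν ?_ u A hR)
      (Finset.sum_le_sum fun ν hν => hC₂ ν (mem_multiIndices.1 hν) u A hR)
    rw [mem_multiIndices.1 hν]
    exact Nat.lt_succ_iff.1 (Finset.mem_range.1 hj)

theorem fract_pos_of_ne {s : ℝ} (hs : Int.fract s ≠ 0) : 0 < Int.fract s :=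
  (Int.fract_nonneg s).lt_of_ne' hs

theorem exists_sobolevENormNonneg_mulDist_le (hn : 0 < n) {s p : ℝ} (hp : 1 < p) (φ : 𝓓(Ω, ℝ)) :
    ∃ C : ℝ≥0, ∀ (u : 𝓓'(Ω, ℝ)) (A : ℝ≥0), sobolevENormNonneg s p u ≤ A →
      sobolevENormNonneg s p (mulDist φ u) ≤ C * A := by
  refine exists_sobolevENormNonneg_le_of_terms_le
    (R := fun u A => sobolevENormNonneg s p u ≤ A) (fun ν hν => ?_) (fun hs ν hν => ?_)
  · obtain ⟨C, hC⟩ := exists_lpENorm_partialD_mulDist_le hp φ ν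
    exact ⟨C, fun u A hA => hC u A fun μ hμ =>
      (lpENorm_le_sobolevENormNonneg u (hμ.trans hν)).trans hA⟩
  · obtain ⟨C, hC⟩ := exists_slobodeckijENorm_partialD_mulDist_le hn hp (fract_pos_of_ne hs)
      (Int.fract_lt_one s) φ ν
    exact ⟨C, fun u A hA => hC u A ⟨fun μ hμ =>
      (lpENorm_le_sobolevENormNonneg u (hμ.trans hν.le)).trans hA, fun μ hμ =>
        (slobodeckijENorm_le_sobolevENormNonneg hs u (hμ.trans hν)).trans hA⟩⟩

theorem exists_sobolevENormNonneg_distDeriv_le {s p : ℝ} (hs : 0 ≤ s) (i : Fin n) :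
    ∃ C : ℝ≥0, ∀ (u : 𝓓'(Ω, ℝ)) (A : ℝ≥0), sobolevENormNonneg (s + 1) p u ≤ A →
      sobolevENormNonneg s p (distDeriv (stdVec i) u) ≤ C * A := by
  have hfl : ⌊s + 1⌋₊ = ⌊s⌋₊ + 1 := Nat.floor_add_one hs
  have hfr : Int.fract (s + 1) = Int.fract s := Int.fract_add_one s
  refine exists_sobolevENormNonneg_le_of_terms_le
    (R := fun u A => sobolevENormNonneg (s + 1) p u ≤ A) (fun ν hν => ⟨1, fun u A hA => ?_⟩)
    (fun hs ν hν => ⟨1, fun u A hA => ?_⟩)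
  · rw [ENNReal.coe_one, one_mul, ← partialD_add_single]
    exact (lpENorm_le_sobolevENormNonneg u (by rw [sum_add_single, hfl]; omega)).trans hA
  · rw [ENNReal.coe_one, one_mul, ← partialD_add_single, ← hfr]
    exact (slobodeckijENorm_le_sobolevENormNonneg (by rwa [hfr]) u
      (by rw [sum_add_single, hfl]; omega)).trans hA

/-- Derivatives of test functions are test functions. For the fractional part write `χ = ρ χ` with
`ρ = 1` on the support of `χ` and use the estimate by first derivatives. -/
theorem sobolevENormNonneg_ofTest_lt_top (hn : 0 < n) {s p : ℝ} (hp : 1 < p) (ψ : 𝓓(Ω, ℝ)) :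
    sobolevENormNonneg s p (ofTest ψ) < ∞ := by
  have hslob : ∀ (hs : Int.fract s ≠ 0) (χ : 𝓓(Ω, ℝ)),
      slobodeckijENorm p (Int.fract s) (ofTest χ) < ∞ := by
    intro hs χ
    obtain ⟨ρ, hρ⟩ := exists_test_eq_one χ
    obtain ⟨C, hC⟩ := exists_slobodeckijENorm_mulDist_le_of_deriv hn hp (fract_pos_of_ne hs)
      (Int.fract_lt_one s) ρ
    have h0 := lpENorm_ofTest_lt_top (p := p) χ
    have h1 : ∀ i : Fin n, lpENorm p (distDeriv (stdVec i) (ofTest χ)) < ∞ := fun i => by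
      rw [← ofTest_testDeriv]; exact lpENorm_ofTest_lt_top _
    -- The sum serves only as a common majorant of all the norms involved.
    have h := hC (ofTest χ) ((lpENorm p (ofTest χ)).toNNReal +
      ∑ i, (lpENorm p (distDeriv (stdVec i) (ofTest χ))).toNNReal)
      (by push_cast; rw [ENNReal.coe_toNNReal h0.ne]; exact le_self_add)
      (fun i => by
        push_cast
        refine le_trans ?_ le_add_self
        refine le_trans (ENNReal.coe_toNNReal (h1 i).ne).ge ?_
        exact Finset.single_le_sum (f := fun i => ((lpENorm p
          (distDeriv (stdVec i) (ofTest χ))).toNNReal : ℝ≥0∞)) (fun _ _ => zero_le)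
          (Finset.mem_univ i))
    rw [← ofTest_mulTest, mulTest_eq_self hρ] at h
    exact h.trans_lt (ENNReal.mul_lt_top (by simp) ENNReal.coe_lt_top)
  rw [sobolevENormNonneg]
  refine ENNReal.add_lt_top.2 ⟨ENNReal.sum_lt_top.2 fun j _ => ENNReal.sum_lt_top.2 fun ν _ => ?_,
    ?_⟩
  · obtain ⟨χ, hχ⟩ := exists_partialD_ofTest ν ψ
    rw [hχ]
    exact lpENorm_ofTest_lt_top χ
  · split_ifs with hs
    · simp
    · refine ENNReal.sum_lt_top.2 fun ν _ => ?_
      obtain ⟨χ, hχ⟩ := exists_partialD_ofTest ν ψ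
      rw [hχ]
      exact hslob hs χ

/-! ### The norm of negative order as a dual norm on test functions -/

theorem ofTest_mem_sobolevZero (hn : 0 < n) {s p : ℝ} (hp : 1 < p) (ψ : 𝓓(Ω, ℝ)) :
    ofTest ψ ∈ SobolevZero s p hp Ω :=
  ⟨sobolevENormNonneg_ofTest_lt_top hn hp ψ, fun ε hε =>
    ⟨ψ, ofTest ψ, represents_ofTest ψ, by rwa [sub_self, sobolevENormNonneg_zero]⟩⟩

/-- The infimum defining the dual norm is not known to be attained, so the bound is proved for every
`B > A` and passes to the limit because the norm of `ψ` is finite. -/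
theorem enorm_apply_le_sobolevENormNeg_mul (hn : 0 < n) {s p : ℝ} (hp : 1 < p) {u : 𝓓'(Ω, ℝ)}
    {A : ℝ≥0} (hu : sobolevENormNeg s p hp u ≤ A) (ψ : 𝓓(Ω, ℝ)) :
    ‖u ψ‖ₑ ≤ A * sobolevENormNonneg (-s) p.conjExponent (ofTest ψ) := by
  have hfin := sobolevENormNonneg_ofTest_lt_top hn (s := -s) (one_lt_conj hp) ψ
  have key : ∀ B : ℝ≥0, A < B →
      ‖u ψ‖ₑ ≤ B * sobolevENormNonneg (-s) p.conjExponent (ofTest ψ) := by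
    intro B hB
    have h := hu.trans_lt (ENNReal.coe_lt_coe.2 hB)
    rw [sobolevENormNeg] at h
    simp only [iInf_lt_iff] at h
    obtain ⟨C, ⟨F, hF, hF'⟩, hC⟩ := h
    set f : SobolevZero (-s) p.conjExponent (one_lt_conj hp) Ω :=
      ⟨ofTest ψ, ofTest_mem_sobolevZero hn _ ψ⟩
    rw [← hF' f ψ (represents_ofTest ψ)]
    exact (hF f).trans (by gcongr)
  set N := sobolevENormNonneg (-s) p.conjExponent (ofTest ψ)
  have hcont : Filter.Tendsto (fun B : ℝ≥0 => (B : ℝ≥0∞) * N) (nhdsWithin A (Ioi A))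
      (nhds (A * N)) :=
    ENNReal.Tendsto.mul_const ((ENNReal.continuous_coe.tendsto A).mono_left nhdsWithin_le_nhds)
      (Or.inr hfin.ne)
  exact ge_of_tendsto hcont (Filter.eventually_of_mem self_mem_nhdsWithin fun B hB => key B hB)

theorem ofTest_injective : Function.Injective (ofTest : 𝓓(Ω, ℝ) → 𝓓'(Ω, ℝ)) := by
  intro φ ψ h
  have h2 := lpReps_ae_eq (p := 2) (by norm_num)
    (u := ofTest φ) ⟨φ.continuous.memLp_of_hasCompactSupport φ.hasCompactSupport,
      represents_ofTest φ⟩ ⟨ψ.continuous.memLp_of_hasCompactSupport ψ.hasCompactSupport,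
      h ▸ represents_ofTest ψ⟩
  have h3 := Measure.eqOn_open_of_ae_eq h2 Ω.isOpen φ.continuous.continuousOn
    ψ.continuous.continuousOn
  ext x
  by_cases hx : x ∈ (Ω : Set (Eucl n))
  · exact h3 hx
  · rw [test_eq_zero_of_notMem φ hx, test_eq_zero_of_notMem ψ hx]

/-- The norm of `W^{s,p}(Ω)` on `W₀^{s,p}(Ω)`, as a seminorm. -/
def sobolevZeroSeminorm (s p : ℝ) (hp : 1 < p) (Ω : Opens (Eucl n)) :
    Seminorm ℝ (SobolevZero s p hp Ω) :=
  Seminorm.ofSMulLE (fun f => (sobolevENormNonneg s p (f : 𝓓'(Ω, ℝ))).toReal)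
    (by simp [sobolevENormNonneg_zero])
    (fun f g => by
      rw [← ENNReal.toReal_add f.2.1.ne g.2.1.ne]
      exact ENNReal.toReal_mono (ENNReal.add_ne_top.2 ⟨f.2.1.ne, g.2.1.ne⟩)
        (sobolevENormNonneg_add hp _ _))
    (fun c f => by
      refine (ENNReal.toReal_mono (ENNReal.mul_ne_top (by simp) f.2.1.ne)
        (sobolevENormNonneg_smul c _)).trans (le_of_eq ?_)
      rw [ENNReal.toReal_mul]; simp)

/-- Injectivity of `ofTest` makes `u` a functional on the image of the test functions in
`SobolevZero`; Hahn–Banach extends it with the same bound. Negative-order estimates thereby reduce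
to inequalities on test functions. -/
theorem sobolevENormNeg_le_of_forall_test (hn : 0 < n) {s p : ℝ} (hp : 1 < p) {u : 𝓓'(Ω, ℝ)}
    {A : ℝ≥0}
    (h : ∀ ψ : 𝓓(Ω, ℝ), ‖u ψ‖ₑ ≤ A * sobolevENormNonneg (-s) p.conjExponent (ofTest ψ)) :
    sobolevENormNeg s p hp u ≤ A := by
  have hq := one_lt_conj hp
  set J : 𝓓(Ω, ℝ) →ₗ[ℝ] SobolevZero (-s) p.conjExponent hq Ω :=
    { toFun := fun ψ => ⟨ofTest ψ, ofTest_mem_sobolevZero hn hq ψ⟩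
      map_add' := fun φ ψ => Subtype.ext (ofTest_add φ ψ)
      map_smul' := fun c φ => Subtype.ext (ofTest_smul c φ) } with hJ
  have hJi : Function.Injective J := fun φ ψ h => ofTest_injective (congrArg Subtype.val h)
  set e := LinearEquiv.ofInjective J hJi
  set U : 𝓓(Ω, ℝ) →ₗ[ℝ] ℝ :=
    { toFun := fun ψ => u ψ, map_add' := map_add u, map_smul' := map_smul u }
  obtain ⟨F, hF, hF'⟩ := Module.Dual.exists_extension_of_le_seminorm (𝕜 := ℝ) (LinearMap.range J)
    (U ∘ₗ e.symm.toLinearMap)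
    (p := A • sobolevZeroSeminorm (-s) p.conjExponent hq Ω) (fun x => by
      obtain ⟨ψ, rfl⟩ := e.surjective x
      have hfin := sobolevENormNonneg_ofTest_lt_top hn (s := -s) hq ψ
      have := ENNReal.toReal_mono (ENNReal.mul_ne_top ENNReal.coe_ne_top hfin.ne) (h ψ)
      rw [ENNReal.toReal_mul, toReal_enorm] at this
      rw [LinearMap.comp_apply, LinearEquiv.coe_coe, e.symm_apply_apply]
      exact this)
  refine iInf₂_le A ⟨F, fun f => ?_, fun f φ hφ => ?_⟩
  · rw [← ofReal_norm, ← ENNReal.ofReal_toReal f.2.1.ne, ← ENNReal.ofReal_coe_nnreal,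
      ← ENNReal.ofReal_mul A.coe_nonneg]
    exact ENNReal.ofReal_le_ofReal (hF' f)
  · have hf : f = (e φ : SobolevZero (-s) p.conjExponent hq Ω) :=
      Subtype.ext (represents_unique hφ (represents_ofTest φ))
    rw [hf, hF, LinearMap.comp_apply, LinearEquiv.coe_coe, e.symm_apply_apply]
    rfl

/-! ### First-order derivatives -/

theorem mem_lpReps_ofTest {p : ℝ} (ψ : 𝓓(Ω, ℝ)) : (ψ : Eucl n → ℝ) ∈ lpReps p (ofTest ψ) :=
  ⟨ψ.continuous.memLp_of_hasCompactSupport ψ.hasCompactSupport, represents_ofTest ψ⟩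

theorem enorm_apply_le_lpENorm_mul {p q : ℝ} (hpq : p.HolderConjugate q) {v : 𝓓'(Ω, ℝ)}
    (hv : lpENorm p v < ∞) (ψ : 𝓓(Ω, ℝ)) :
    ‖v ψ‖ₑ ≤ lpENorm p v * lpENorm q (ofTest ψ) := by
  obtain ⟨f, hf, hfm⟩ := exists_measurable_rep hv
  rw [hf.2 ψ, lpENorm_eq hpq.lt hf, lpENorm_eq hpq.symm.lt (mem_lpReps_ofTest ψ)]
  refine (enorm_integral_le_lintegral_enorm _).trans ?_
  simp only [enorm_mul]
  exact ENNReal.lintegral_mul_le_Lp_mul_Lq _ hpq hfm.enorm.aemeasurable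
    ψ.continuous.measurable.enorm.aemeasurable

theorem lpENorm_le_sobolevENormNonneg' {s p : ℝ} (u : 𝓓'(Ω, ℝ)) :
    lpENorm p u ≤ sobolevENormNonneg s p u := by
  simpa [partialD_zero] using lpENorm_le_sobolevENormNonneg (s := s) (p := p) u (ν := 0) (by simp)

theorem slobodeckijENorm_le_sobolevENormNonneg' {s p : ℝ} (hs0 : 0 < s) (hs1 : s < 1)
    (u : 𝓓'(Ω, ℝ)) : slobodeckijENorm p s u ≤ sobolevENormNonneg s p u := by
  have hfr : Int.fract s = s := Int.fract_eq_self.2 ⟨hs0.le, hs1⟩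
  have hfl : ⌊s⌋₊ = 0 := Nat.floor_eq_zero.2 hs1
  have h := slobodeckijENorm_le_sobolevENormNonneg (p := p) (s := s) (by rw [hfr]; exact hs0.ne')
    u (ν := 0) (by simp [hfl])
  rwa [hfr, partialD_zero] at h

/-- For `0 < s < 1`, the derivative of a distribution in `W^{s,p}(Ω)` defines locally a bounded
functional for the norm of order `1 - s`. -/
theorem exists_enorm_apply_testDeriv_le (hn : 0 < n) {p q s : ℝ} (hpq : p.HolderConjugate q)
    (hs0 : 0 < s) (hs1 : s < 1) (φ : 𝓓(Ω, ℝ)) (i : Fin n) :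
    ∃ C : ℝ≥0, ∀ (v : 𝓓'(Ω, ℝ)) (A : ℝ≥0), sobolevENormNonneg s p v ≤ A →
      ∀ (ψ : 𝓓(Ω, ℝ)) (B : ℝ≥0), sobolevENormNonneg (1 - s) q (ofTest ψ) ≤ B →
      ‖v (testDeriv (stdVec i) (mulTest φ ψ))‖ₑ ≤ C * (A * B) := by
  have hp := hpq.lt
  have hq := hpq.symm.lt
  have ht0 : 0 < 1 - s := sub_pos.2 hs1
  have ht1 : 1 - s < 1 := by linarith
  -- Inserting `χ` next to `f` does not change the pairing with `∂ᵢ(φ ψ)`, and it gives an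
  -- integrable function on `ℝⁿ` with finite Slobodeckij seminorm there.
  obtain ⟨χ, hχ⟩ := exists_test_eq_one φ
  obtain ⟨K, hK⟩ := exists_integral_lineDeriv_le (n := n) hpq hs0 hs1
  obtain ⟨C₁, hC₁⟩ := exists_lintegral_test_mul_le hp χ
  obtain ⟨C₂, hC₂⟩ := exists_lintegral_test_mul_le hq φ
  obtain ⟨C₃, hC₃⟩ := exists_gagliardo_mul_rep_le hn hp hs0 hs1 χ
  obtain ⟨C₄, hC₄⟩ := exists_gagliardo_mul_rep_le hn hq ht0 ht1 φ
  refine ⟨K * (C₁ ^ (1 / p) * C₂ ^ (1 / q) + C₃ ^ (1 / p) * C₄ ^ (1 / q)),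
    fun v A hA ψ B hB => ?_⟩
  have hA1 := (lpENorm_le_sobolevENormNonneg' v).trans hA
  have hA2 := (slobodeckijENorm_le_sobolevENormNonneg' hs0 hs1 v).trans hA
  have hB1 := (lpENorm_le_sobolevENormNonneg' (ofTest ψ)).trans hB
  have hB2 := (slobodeckijENorm_le_sobolevENormNonneg' ht0 ht1 (ofTest ψ)).trans hB
  obtain ⟨f, hf, hfm⟩ := exists_measurable_rep (hA1.trans_lt ENNReal.coe_lt_top)
  have hψ := mem_lpReps_ofTest (p := q) ψ
  have e : v (testDeriv (stdVec i) (mulTest φ ψ)) =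
      ∫ x, lineDeriv ℝ (fun y => φ y * ψ y) x (stdVec i) * (χ x * f x) := by
    rw [hf.2, setIntegral_eq_integral_mul_test]
    congr 1; ext x
    by_cases hx : x ∈ tsupport φ
    · rw [hχ x hx, testDeriv_apply, one_mul, mul_comm]
      rfl
    · have h0 : testDeriv (stdVec i) (mulTest φ ψ) x = 0 :=
        image_eq_zero_of_notMem_tsupport fun h =>
          hx (tsupport_mul_subset_left (tsupport_testDeriv_subset _ _ h))
      have h0' := h0
      rw [testDeriv_apply] at h0'
      change lineDeriv ℝ (fun y => φ y * ψ y) x (stdVec i) = 0 at h0'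
      rw [h0, h0', mul_zero, zero_mul]
  have h := hK (fun x => χ x * f x) (fun x => φ x * ψ x) (χ.continuous.measurable.mul hfm)
    (integrable_test_mul_rep hp χ hf) (contDiff_test (mulTest φ ψ) 1)
    (mulTest φ ψ).hasCompactSupport (stdVec i) (by simp)
  have b1 : (∫⁻ x, ‖χ x * f x‖ₑ ^ p) ^ (1 / p) ≤ ((C₁ ^ (1 / p) : ℝ≥0) : ℝ≥0∞) * A := by
    rw [← coe_mul_rpow_le hp]
    refine ENNReal.rpow_le_rpow ((hC₁ f).trans ?_) (by positivity)
    gcongr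
    exact rpow_le_of_lpENorm_le hp hf hA1
  have b2 : (∫⁻ x, ‖φ x * ψ x‖ₑ ^ q) ^ (1 / q) ≤ ((C₂ ^ (1 / q) : ℝ≥0) : ℝ≥0∞) * B := by
    rw [← coe_mul_rpow_le hq]
    refine ENNReal.rpow_le_rpow ((hC₂ ψ).trans ?_) (by positivity)
    gcongr
    exact rpow_le_of_lpENorm_le hq hψ hB1
  have b3 : gagliardo p s (fun x => χ x * f x) ^ (1 / p) ≤
      ((C₃ ^ (1 / p) : ℝ≥0) : ℝ≥0∞) * A := by
    rw [← coe_mul_rpow_le hp]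
    exact ENNReal.rpow_le_rpow (hC₃ v A f hf hfm hA1 hA2) (by positivity)
  have b4 : gagliardo q (1 - s) (fun x => φ x * ψ x) ^ (1 / q) ≤
      ((C₄ ^ (1 / q) : ℝ≥0) : ℝ≥0∞) * B := by
    rw [← coe_mul_rpow_le hq]
    exact ENNReal.rpow_le_rpow (hC₄ _ B ψ hψ ψ.continuous.measurable hB1 hB2) (by positivity)
  rw [e]
  refine h.trans ((mul_le_mul_right (add_le_add (mul_le_mul' b1 b2) (mul_le_mul' b3 b4)) _).trans
    (le_of_eq ?_))
  push_cast
  ring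

/-- At `s = 0` the norm is not defined by duality; Hölder's inequality gives the same bound, so that
`s = 0` joins the dual case. -/
theorem enorm_apply_le_of_nonpos (hn : 0 < n) {s p : ℝ} (hp : 1 < p) (hs : s ≤ 0)
    {v : 𝓓'(Ω, ℝ)} {A : ℝ≥0} (hv : sobolevENorm s p hp v ≤ A) (ψ : 𝓓(Ω, ℝ)) :
    ‖v ψ‖ₑ ≤ A * sobolevENormNonneg (-s) p.conjExponent (ofTest ψ) := by
  rcases hs.lt_or_eq with hs | rfl
  · rw [sobolevENorm, if_neg (not_le.2 hs)] at hv
    exact enorm_apply_le_sobolevENormNeg_mul hn hp hv ψ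
  · rw [sobolevENorm, if_pos le_rfl] at hv
    have hv := (lpENorm_le_sobolevENormNonneg' v).trans hv
    refine (enorm_apply_le_lpENorm_mul (Real.HolderConjugate.conjExponent hp)
      (hv.trans_lt ENNReal.coe_lt_top) ψ).trans ?_
    gcongr
    exact lpENorm_le_sobolevENormNonneg' _

/-- For `s ≤ 0` the derivative is absorbed by the test function, whose order `1 - s ≥ 1` drops to
`-s ≥ 0`. For `0 < s < 1` neither factor has a full derivative to spare, and the fractional pairing
estimate takes over. -/
theorem exists_enorm_apply_testDeriv_mulTest_le (hn : 0 < n) {s p : ℝ} (hp : 1 < p) (hs : s < 1)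
    (φ : 𝓓(Ω, ℝ)) (i : Fin n) :
    ∃ C : ℝ≥0, ∀ (v : 𝓓'(Ω, ℝ)) (A : ℝ≥0), sobolevENorm s p hp v ≤ A →
      ∀ (ψ : 𝓓(Ω, ℝ)) (B : ℝ≥0), sobolevENormNonneg (1 - s) p.conjExponent (ofTest ψ) ≤ B →
      ‖v (testDeriv (stdVec i) (mulTest φ ψ))‖ₑ ≤ C * (A * B) := by
  have hq := one_lt_conj hp
  rcases le_or_gt s 0 with hs0 | hs0
  · obtain ⟨C₁, hC₁⟩ := exists_sobolevENormNonneg_mulDist_le hn (s := 1 - s) hq φ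
    obtain ⟨C₂, hC₂⟩ := exists_sobolevENormNonneg_distDeriv_le (s := -s) (p := p.conjExponent)
      (Ω := Ω) (neg_nonneg.2 hs0) i
    refine ⟨C₂ * C₁, fun v A hA ψ B hB => ?_⟩
    refine (enorm_apply_le_of_nonpos hn hp hs0 hA _).trans ?_
    have h1 := hC₁ (ofTest ψ) B hB
    have h2 : sobolevENormNonneg (-s) p.conjExponent
        (ofTest (testDeriv (stdVec i) (mulTest φ ψ))) ≤ C₂ * (C₁ * B : ℝ≥0) := by
      rw [ofTest_testDeriv, ofTest_mulTest]
      refine hC₂ _ _ ?_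
      rw [neg_add_eq_sub]
      simpa using h1
    refine (mul_le_mul_right h2 _).trans (le_of_eq ?_)
    push_cast
    ring
  · obtain ⟨C, hC⟩ := exists_enorm_apply_testDeriv_le hn (Real.HolderConjugate.conjExponent hp)
      hs0 hs φ i
    refine ⟨C, fun v A hA => hC v A ?_⟩
    rwa [sobolevENorm, if_pos hs0.le] at hA

/-- The operator `v ↦ φ ∂ᵢ v` is bounded from `W^{s,p}(Ω)` to `W^{s-1,p}(Ω)`, for every real `s`
and every open set `Ω`. -/
theorem exists_sobolevENorm_mulDist_distDeriv_le (hn : 0 < n) (s : ℝ) {p : ℝ} (hp : 1 < p)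
    (φ : 𝓓(Ω, ℝ)) (i : Fin n) :
    ∃ C : ℝ≥0, ∀ (v : 𝓓'(Ω, ℝ)) (A : ℝ≥0), sobolevENorm s p hp v ≤ A →
      sobolevENorm (s - 1) p hp (mulDist φ (distDeriv (stdVec i) v)) ≤ C * A := by
  -- The target order `s - 1` is nonnegative in the first case; in the second it is negative and its
  -- norm is tested by duality.
  rcases le_or_gt 1 s with hs | hs
  · obtain ⟨C₁, hC₁⟩ := exists_sobolevENormNonneg_mulDist_le hn (s := s - 1) hp φ
    obtain ⟨C₂, hC₂⟩ := exists_sobolevENormNonneg_distDeriv_le (s := s - 1) (p := p)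
      (Ω := Ω) (sub_nonneg.2 hs) i
    refine ⟨C₁ * C₂, fun v A hA => ?_⟩
    rw [sobolevENorm, if_pos (by linarith)] at hA
    rw [sobolevENorm, if_pos (by linarith), ENNReal.coe_mul, mul_assoc, ← ENNReal.coe_mul C₂]
    refine hC₁ _ _ ?_
    rw [ENNReal.coe_mul]
    exact hC₂ v A (by rwa [sub_add_cancel])
  · obtain ⟨C, hC⟩ := exists_enorm_apply_testDeriv_mulTest_le hn hp hs φ i
    refine ⟨C, fun v A hA => ?_⟩
    rw [sobolevENorm, if_neg (by linarith), ← ENNReal.coe_mul]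
    refine sobolevENormNeg_le_of_forall_test hn hp fun ψ => ?_
    have hfin := sobolevENormNonneg_ofTest_lt_top hn (s := 1 - s) (one_lt_conj hp) ψ
    have h := hC v A hA ψ _ (ENNReal.coe_toNNReal hfin.ne).ge
    rw [ENNReal.coe_toNNReal hfin.ne] at h
    rw [neg_sub, mulDist_apply, distDeriv_apply, enorm_neg, ENNReal.coe_mul, mul_assoc]
    exact h

/-! ### The operators on locally Sobolev spaces -/

/-- The global estimate is applied to `χ u`, which lies in `W^{s,p}(Ω)` although `u` itself need
not. One seminorm of the source thus controls each seminorm of the target, which is continuity. -/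
theorem sobolevENorm_mulDist_distDeriv_toDistribution_le (hn : 0 < n) {s p : ℝ} (hp : 1 < p)
    (i : Fin n) (φ : 𝓓(Ω, ℝ)) :
    ∃ (χ : 𝓓(Ω, ℝ)) (C : ℝ≥0), ∀ u : LocSobolev s p hp Ω,
      sobolevENorm (s - 1) p hp
        (mulDist φ (distDeriv (stdVec i) (LocSobolev.toDistribution u))) ≤
      C * sobolevENorm s p hp (mulDist χ (LocSobolev.toDistribution u)) := by
  obtain ⟨χ, hχ⟩ := exists_test_eq_one φ
  obtain ⟨C, hC⟩ := exists_sobolevENorm_mulDist_distDeriv_le hn s hp φ i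
  refine ⟨χ, C, fun u => ?_⟩
  have hfin := (LocSobolev.sobolevENorm_mulDist_lt_top u χ).ne
  rw [← mulDist_distDeriv_mulDist hχ, ← ENNReal.coe_toNNReal hfin]
  exact hC _ _ (ENNReal.coe_toNNReal hfin).ge

/-- The operator `D` restricts to a continuous linear map between locally Sobolev spaces. -/
def MapsContinuously (D : 𝓓'(Ω, ℝ) → 𝓓'(Ω, ℝ)) (s t p : ℝ) (hp : 1 < p) : Prop :=
  ∃ T : LocSobolev s p hp Ω →L[ℝ] LocSobolev t p hp Ω,
    ∀ u, LocSobolev.toDistribution (T u) = D (LocSobolev.toDistribution u)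

theorem MapsContinuously.comp {D E : 𝓓'(Ω, ℝ) → 𝓓'(Ω, ℝ)} {r s t p : ℝ} {hp : 1 < p}
    (hE : MapsContinuously E s t p hp) (hD : MapsContinuously D r s p hp) :
    MapsContinuously (fun u => E (D u)) r t p hp := by
  obtain ⟨S, hS⟩ := hE
  obtain ⟨T, hT⟩ := hD
  exact ⟨S ∘L T, fun u => by rw [ContinuousLinearMap.comp_apply, hS, hT]⟩

theorem mapsContinuously_distDeriv (hn : 0 < n) (s : ℝ) {p : ℝ} (hp : 1 < p) (i : Fin n) :
    MapsContinuously (Ω := Ω) (distDeriv (stdVec i)) s (s - 1) p hp := by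
  have hbound := sobolevENorm_mulDist_distDeriv_toDistribution_le (Ω := Ω) hn (s := s) hp i
  have hmem : ∀ u : LocSobolev s p hp Ω, distDeriv (stdVec i) (LocSobolev.toDistribution u) ∈
      locSobolevSubmodule (s - 1) p hp Ω := by
    intro u
    refine mem_locSobolevSubmodule.2 fun φ => ?_
    obtain ⟨χ, C, hC⟩ := hbound φ
    exact (hC u).trans_lt (ENNReal.mul_lt_top (by simp)
      (LocSobolev.sobolevENorm_mulDist_lt_top u χ))
  set T : LocSobolev s p hp Ω →ₗ[ℝ] LocSobolev (s - 1) p hp Ω :=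
    ((distDeriv (stdVec i)).toLinearMap ∘ₗ LocSobolev.toDistribution).codRestrict
      (locSobolevSubmodule (s - 1) p hp Ω) hmem
  have hT : ∀ u, LocSobolev.toDistribution (T u) =
      distDeriv (stdVec i) (LocSobolev.toDistribution u) := fun u => rfl
  refine ⟨⟨T, ?_⟩, hT⟩
  refine WithSeminorms.continuous_of_isBounded LocSobolev.withSeminorms LocSobolev.withSeminorms
    T fun φ => ?_
  obtain ⟨χ, C, hC⟩ := hbound φ
  refine ⟨{χ}, C, fun u => ?_⟩
  rw [Finset.sup_singleton, Seminorm.comp_apply, smul_apply, LocSobolev.seminorm_apply,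
    LocSobolev.seminorm_apply, hT]
  have hfin := (LocSobolev.sobolevENorm_mulDist_lt_top u χ).ne
  have h := ENNReal.toReal_mono (ENNReal.mul_ne_top ENNReal.coe_ne_top hfin) (hC u)
  rwa [ENNReal.toReal_mul] at h

theorem mapsContinuously_partialD (hn : 0 < n) {p : ℝ} (hp : 1 < p) (s : ℝ) (α : Fin n → ℕ) :
    MapsContinuously (partialD Ω α) s (s - ((∑ i, α i : ℕ) : ℝ)) p hp := by
  induction hk : ∑ i, α i generalizing α s with
  | zero =>
    have : α = 0 := by ext i; simpa using (Finset.sum_eq_zero_iff.1 hk) i (Finset.mem_univ i)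
    rw [Nat.cast_zero, sub_zero]
    exact ⟨ContinuousLinearMap.id ℝ _, fun u => by rw [this, partialD_zero]; rfl⟩
  | succ k ih =>
    obtain ⟨μ, i, rfl, hμ⟩ := exists_eq_add_single hk
    -- The innermost derivative acts first, from order `s` to `s - 1`; hence the induction
    -- hypothesis is needed at `s - 1`, which is why `s` is generalized.
    have h := (ih (s - 1) μ hμ).comp (mapsContinuously_distDeriv hn s hp i)
    have e : s - ((k + 1 : ℕ) : ℝ) = s - 1 - k := by push_cast; ring
    rw [e]
    obtain ⟨T, hT⟩ := h
    exact ⟨T, fun u => by rw [hT, partialD_add_single]⟩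

/-- On every open set `Ω`, `∂^α : W^{s,p}_loc(Ω) → W^{s-|α|,p}_loc(Ω)` is well defined and
continuous. -/
theorem derivWellDefinedContinuous (hn : 0 < n) (s p : ℝ) (hp : 1 < p) (α : Fin n → ℕ)
    (Ω : Opens (Eucl n)) : DerivWellDefinedContinuous s p hp α Ω :=
  mapsContinuously_partialD hn hp s α

end LocSob

end

/-! ### The theorem on `ℝⁿ` and on bounded Lipschitz domains -/

theorem mainTheorem12 (n : ℕ) (hn : 0 < n) (s p : ℝ) (hp : 1 < p) (α : Fin n → ℕ) :
    LocSob.DerivWellDefinedContinuous s p hp α (⊤ : Opens (LocSob.Eucl n)) ∧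
    ∀ Ω : Opens (LocSob.Eucl n), (Ω : Set (LocSob.Eucl n)).Nonempty →
      Bornology.IsBounded (Ω : Set (LocSob.Eucl n)) → LocSob.HasLipschitzBoundary Ω →
      (s < 0 → LocSob.DerivWellDefinedContinuous s p hp α Ω) ∧
      (0 ≤ s → ((∑ i, α i : ℕ) : ℝ) ≤ s → LocSob.DerivWellDefinedContinuous s p hp α Ω) ∧
      (0 ≤ s → (∀ m : ℤ, s - 1 / p ≠ m) → s < ((∑ i, α i : ℕ) : ℝ) →
        LocSob.DerivWellDefinedContinuous s p hp α Ω) := by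
  exact ⟨LocSob.derivWellDefinedContinuous hn s p hp α _, fun Ω _ _ _ =>
    ⟨fun _ => LocSob.derivWellDefinedContinuous hn s p hp α Ω,
      fun _ _ => LocSob.derivWellDefinedContinuous hn s p hp α Ω,
      fun _ _ _ => LocSob.derivWellDefinedContinuous hn s p hp α Ω⟩⟩
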